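/- **Setting.** Consider the exterior $r>r_H>0$ of a stationary, axisymmetric, circular black hole, in coordinates $(t,r,\theta,\phi)$ of Hartle–Thorne type, $$ds^2=-N^2dt^2+A^2dr^2+r^2B^2\left\{d\theta^2+\sin^2\theta\,(d\phi-\omega\,dt)^2\right\},$$ where $N,A,B>0$ and $\omega$ are $C^2$ functions of $(r,\theta)$, regular on the axis. Below, a remainder $\mathcal O(r^{-p})$ is a $C^2$ function $f(r,\theta)$ (for large $r$) with $\partial_r^i\partial_\theta^jf=\mathcal O(r^{-p-i})$ uniformly in $\theta$ for $i+j\le 2$. The coordinates are asymptotically mass centered: $$N=1-\tfrac Mr+\mathcal O(r^{-2}),\quad A=1+\tfrac Mr+\mathcal O(r^{-2}),\quad B=1+\mathcal O(r^{-2}),\quad \omega=\tfrac{2J}{r^3}+\mathcal O(r^{-4}).$$ The surface $r=r_H$ is the event horizon, with angular velocity $\Omega$: in coordinates $(v,x,y,z)$, where $v=t+\alpha(r,\theta)$ and $(x,y,z)$ has spherical coordinates $(r,\theta,\phi+\beta(r,\theta))$ for some $C^1$ functions $\alpha,\beta$ on the exterior, the metric extends to a continuous Lorentzian metric on $\{x^2+y^2+z^2\ge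 r_H^2\}$, and $\{x^2+y^2+z^2=r_H^2\}$ is a null hypersurface generated by $X=\partial_t+\Omega\,\partial_\phi$. Let $\epsilon\in\mathbb R$ and let $\mathcal F(r,\theta)$ be continuous for $r\ge r_H$, $0\le\theta\le\pi$, with $|\mathcal F|\le C r^{-5}$ for large $r$. Let $\Phi(r,\theta)$ be a stationary, axisymmetric solution of $\Box\Phi+\epsilon\mathcal F=0$ in the exterior, $C^2$ up to and including the horizon, with $$\Phi=\frac{\mu_1(\theta)}r+\frac{\mu_2(\theta)}{r^2}+\mathcal O(r^{-3}),$$ and let $\mu_{(2,1)}=\frac32\int_0^\pi\mu_2(\theta)\cos\theta\,\sin\theta\,d\theta$ be the coefficient of $P_1(\cos\theta)=\cos\theta$ in the Legendre expansion of $\mu_2$. Let $\phi_0(r,\theta)$ be a stationary, axisymmetric solution of $\Box\phi_0=0$ in the exterior, $C^2$ up to and including the horizon, such that $\phi_0/(rP_1(\cos\theta))\to1$ as $r\to\infty$ for every $\theta\in[0,\pi]$ with $\cos\theta\neq0$, and such that this quotient has a regular expansion in powers of $1/r$: for all large $r$ and all $\theta$, $$\phi_0=r\cos\theta\left[c_0(\theta)+\frac{c_1(\theta)}r+\mathcal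 O(r^{-2})\right]$$ with continuous functions $c_0,c_1$. Let $\Sigma$ denote a partial Cauchy surface of the exterior from the horizon to infinity, that is, a $C^1$ spacelike hypersurface that meets the orbit of $(\partial_t,\partial_\phi)$ through each $(r,\theta)$, $r>r_H$, $0<\theta<\pi$, in a closed curve going once around the axis and that has a $C^1$ parametrization by $(r,\theta)$ and the curve parameter; $d\Sigma_\mu$ is its future directed surface element (equal to $\sqrt{-g}\,\partial_\mu t\,dr\,d\theta\,d\phi$ on a surface $t=\mathrm{const}$). **Claim.** 1. $\phi_0=r\cos\theta\left[1-\dfrac Mr+\mathcal O(r^{-2})\right]$. 2. $\mu_1$ is a constant, and $\mu_2(\theta)=M\mu_1+\mu_{(2,1)}P_1(\cos\theta)$. 3. For every $\Sigma$ on which the integral converges absolutely, and this includes every axisymmetric $\Sigma$ (in particular the surfaces of constant $t$), $$\mu_{(2,1)}=\frac{\epsilon}{4\pi}\int_\Sigma\mathcal F\,\phi_0\,X^\mu\,d\Sigma_\mu .$$ -/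

import Mathlib

open Real Set Filter Topology MeasureTheory
open scoped Matrix

noncomputable section

namespace ScalarHair

/-! ### Wave operator and hypersurface flux in a four-dimensional chart -/

/-- The coordinates of a point of a four-dimensional chart. -/
abbrev Coord : Type := Fin 4 → ℝ

/-- The coordinate derivative of `f` in the direction of the coordinate `μ`. -/
def partialDeriv (μ : Fin 4) (f : Coord → ℝ) (x : Coord) : ℝ :=
  fderiv ℝ f x (Pi.single μ 1)

/-- The volume density `√(-det g)` of a Lorentzian metric `g`. -/
def volumeDensity (g : Coord → Matrix (Fin 4) (Fin 4) ℝ) (x : Coord) : ℝ :=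
  √(-(g x).det)

/-- The wave operator `□ f = (1/√-g) ∂_μ (√-g g^{μν} ∂_ν f)` of the metric `g`. -/
def dAlembertian (g : Coord → Matrix (Fin 4) (Fin 4) ℝ) (f : Coord → ℝ) (x : Coord) : ℝ :=
  1 / volumeDensity g x * ∑ μ, partialDeriv μ
    (fun y => volumeDensity g y * ∑ ν, (g y)⁻¹ μ ν * partialDeriv ν f y) x

/-- A stationary and axisymmetric function, given by its dependence on `(r, θ)`, as a function of
the coordinates `(t, r, θ, φ)`. -/
def lift (f : ℝ → ℝ → ℝ) (x : Coord) : ℝ := f (x 1) (x 2)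

/-! ### Regularity on the axis and orders at infinity

An axisymmetric function on a sphere is regular at the two poles exactly when, as a function of the
polar angle, it is the restriction of a regular function on `ℝ` which is even and `2π`-periodic.
So functions of `(r, θ)` are defined for all real `θ`. -/

/-- `f` is even and `2π`-periodic in the polar angle at each radius in `I`. -/
def IsAxisSymmetric (I : Set ℝ) (f : ℝ → ℝ → ℝ) : Prop :=
  ∀ r ∈ I, ∀ θ, f r (-θ) = f r θ ∧ f r (θ + 2 * π) = f r θ

/-- `f` is a twice continuously differentiable axisymmetric function of a point of space whose
radius is in `I`, poles included. -/
def IsRegularOn (I : Set ℝ) (f : ℝ → ℝ → ℝ) : Prop :=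
  ContDiffOn ℝ 2 (Function.uncurry f) (I ×ˢ univ) ∧ IsAxisSymmetric I f

/-- The derivative `∂_r`. -/
def radialDeriv (f : ℝ → ℝ → ℝ) (r θ : ℝ) : ℝ := deriv (fun s => f s θ) r

/-- The derivative `∂_θ`. -/
def angularDeriv (f : ℝ → ℝ → ℝ) (r θ : ℝ) : ℝ := deriv (f r) θ

/-- `f = O(r^{-p})` as `r → ∞`, uniformly in the angle, for a remainder of an expansion in powers
of `1/r` that may be differentiated twice term by term: `∂_r^i ∂_θ^j f = O(r^{-p-i})` for
`i + j ≤ 2`. -/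
def IsRemainder (p : ℕ) (f : ℝ → ℝ → ℝ) : Prop :=
  ∃ R C : ℝ, 0 < R ∧ ContDiffOn ℝ 2 (Function.uncurry f) (Ioi R ×ˢ univ) ∧
    ∀ r, R < r → ∀ θ, ∀ i j : ℕ, i + j ≤ 2 →
      |(radialDeriv^[i] (angularDeriv^[j] f)) r θ| ≤ C / r ^ (p + i)

/-! ### Stationary, axisymmetric, circular exteriors -/

/-- The metric functions of a stationary, axisymmetric and circular exterior `r > rH` in
coordinates `(t, r, θ, φ)` of Hartle-Thorne type. -/
structure HartleThorne where
  rH : ℝ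
  N : ℝ → ℝ → ℝ
  A : ℝ → ℝ → ℝ
  B : ℝ → ℝ → ℝ
  ω : ℝ → ℝ → ℝ
  rH_pos : 0 < rH
  N_regular : IsRegularOn (Ioi rH) N
  A_regular : IsRegularOn (Ioi rH) A
  B_regular : IsRegularOn (Ioi rH) B
  ω_regular : IsRegularOn (Ioi rH) ω
  N_pos : ∀ r, rH < r → ∀ θ, 0 < N r θ
  A_pos : ∀ r, rH < r → ∀ θ, 0 < A r θ
  B_pos : ∀ r, rH < r → ∀ θ, 0 < B r θ

namespace HartleThorne

variable (S : HartleThorne)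

/-- The metric
`-N² dt² + A² dr² + r² B² (dθ² + sin² θ (dφ - ω dt)²)`. -/
def metric (x : Coord) : Matrix (Fin 4) (Fin 4) ℝ :=
  let r := x 1
  let θ := x 2
  let N := S.N r θ
  let A := S.A r θ
  let B := S.B r θ
  let w := S.ω r θ
  !![-N ^ 2 + r ^ 2 * B ^ 2 * sin θ ^ 2 * w ^ 2, 0, 0, -(r ^ 2 * B ^ 2 * sin θ ^ 2 * w);
     0, A ^ 2, 0, 0;
     0, 0, r ^ 2 * B ^ 2, 0;
     -(r ^ 2 * B ^ 2 * sin θ ^ 2 * w), 0, 0, r ^ 2 * B ^ 2 * sin θ ^ 2]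

/-- The exterior region in the coordinates `(t, r, θ, φ)`, off the axis. -/
def exterior : Set Coord := {x | S.rH < x 1 ∧ x 2 ∈ Ioo 0 π}

/-- The coordinates are asymptotically mass centered, with mass `M` and angular momentum `J`. -/
def IsAMC (M J : ℝ) : Prop :=
  IsRemainder 2 (fun r θ => S.N r θ - (1 - M / r)) ∧
  IsRemainder 2 (fun r θ => S.A r θ - (1 + M / r)) ∧
  IsRemainder 2 (fun r θ => S.B r θ - 1) ∧
  IsRemainder 4 (fun r θ => S.ω r θ - 2 * J / r ^ 3)

/-- The change from `(t, r, θ, φ)` to coordinates `(v, x, y, z)` with `v = t + α(r, θ)` and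
`(x, y, z)` the point with spherical coordinates `(r, θ, φ + β(r, θ))`. -/
def ingoingMap (α β : ℝ → ℝ → ℝ) (p : Coord) : Coord :=
  let r := p 1
  let θ := p 2
  let ψ := p 3 + β r θ
  ![p 0 + α r θ, r * sin θ * cos ψ, r * sin θ * sin ψ, r * cos θ]

/-- The Jacobian matrix of a map of charts. -/
def jacobian (f : Coord → Coord) (p : Coord) : Matrix (Fin 4) (Fin 4) ℝ :=
  Matrix.of fun μ ν => partialDeriv ν (fun q => f q μ) p

/-- The vector field `∂_v + Ω (x ∂_y - y ∂_x)` in the coordinates `(v, x, y, z)`; this is the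
Killing field `∂_t + Ω ∂_φ`. -/
def generatorCartesian (Ω : ℝ) (x : EuclideanSpace ℝ (Fin 3)) : Coord :=
  ![1, -(Ω * x 1), Ω * x 0, 0]

/-- The surface `r = rH` is the horizon, with angular velocity `Ω`: in suitable coordinates
`(v, x, y, z)` that are obtained from `(t, r, θ, φ)` by a change of the form `ingoingMap`, the
metric of the exterior extends to a continuous Lorentzian metric `G` on the region
`‖(x, y, z)‖ ≥ rH`, and the hypersurface `‖(x, y, z)‖ = rH` is a null hypersurface generated by
the Killing field `X = ∂_t + Ω ∂_φ`, that is, the tangent vector `X` is orthogonal to each vector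
`w` tangent to it (also to itself). -/
def HasHorizon (Ω : ℝ) : Prop :=
  ∃ (α β : ℝ → ℝ → ℝ) (G : EuclideanSpace ℝ (Fin 3) → Matrix (Fin 4) (Fin 4) ℝ),
    ContDiffOn ℝ 1 (Function.uncurry α) (Ioi S.rH ×ˢ Ioo 0 π) ∧
    ContDiffOn ℝ 1 (Function.uncurry β) (Ioi S.rH ×ˢ Ioo 0 π) ∧
    ContinuousOn G {x | S.rH ≤ ‖x‖} ∧
    (∀ x, S.rH ≤ ‖x‖ → (G x).IsSymm ∧ (G x).det < 0) ∧
    (∀ p ∈ S.exterior,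
      S.metric p = (jacobian (ingoingMap α β) p)ᵀ *
        G !₂[ingoingMap α β p 1, ingoingMap α β p 2, ingoingMap α β p 3] *
          jacobian (ingoingMap α β) p) ∧
    ∀ x : EuclideanSpace ℝ (Fin 3), ‖x‖ = S.rH → ∀ w : Coord,
      x 0 * w 1 + x 1 * w 2 + x 2 * w 3 = 0 → generatorCartesian Ω x ⬝ᵥ (G x *ᵥ w) = 0

/-- The Killing field `X = ∂_t + Ω ∂_φ` in the coordinates `(t, r, θ, φ)`. -/
def generator (Ω : ℝ) : Coord := ![1, 0, 0, Ω]

/-- The parameter domain `r > rH`, `0 < θ < π` with an angle `u` in a given set. -/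
def parameterDomain (U : Set ℝ) : Set (ℝ × ℝ × ℝ) := Ioi S.rH ×ˢ Ioo 0 π ×ˢ U

/-- A partial Cauchy surface of the exterior, reaching from the horizon to infinity: a spacelike
hypersurface which meets the orbit `{(t, φ)}` of the two Killing fields through each `(r, θ)` in a
closed curve `u ↦ (T, P)` that goes around the axis once. No condition is imposed on `T` as
`r → rH`, so the surface may end on the future horizon or on the bifurcation sphere. -/
structure PartialCauchySurface where
  T : ℝ × ℝ × ℝ → ℝ
  P : ℝ × ℝ × ℝ → ℝ
  T_contDiff : ContDiffOn ℝ 1 T (S.parameterDomain univ)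
  P_contDiff : ContDiffOn ℝ 1 P (S.parameterDomain univ)
  T_periodic : ∀ r θ u, T (r, θ, u + 2 * π) = T (r, θ, u)
  P_periodic : ∀ r θ u, P (r, θ, u + 2 * π) = P (r, θ, u) + 2 * π
  spacelike : ∀ p ∈ S.parameterDomain univ, ∀ w : ℝ × ℝ × ℝ, w ≠ 0 →
    let v : Coord := fderiv ℝ (fun q : ℝ × ℝ × ℝ => ![T q, q.1, q.2.1, P q]) p w
    0 < v ⬝ᵥ (S.metric ![T p, p.1, p.2.1, P p] *ᵥ v)

namespace PartialCauchySurface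

variable {S}

/-- The parametrization `(r, θ, u) ↦ (T, r, θ, P)` of the surface. -/
def param (K : S.PartialCauchySurface) (p : ℝ × ℝ × ℝ) : Coord :=
  ![K.T p, p.1, p.2.1, K.P p]

/-- The surface is invariant under rotations about the axis. -/
def IsAxisymmetric (K : S.PartialCauchySurface) : Prop :=
  ∀ r θ u, K.T (r, θ, u) = K.T (r, θ, 0) ∧ K.P (r, θ, u) = K.P (r, θ, 0) + u

/-- The integrand of `∫ f X^μ dΣ_μ` in the parameters `(r, θ, u)`, where
`dΣ_μ = √-g ε_{μνρσ} ∂_r x^ν ∂_θ x^ρ ∂_u x^σ dr dθ du` is the future directed surface element (on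
a surface of constant `t` this is `√-g ∂_μ t dr dθ dφ`). -/
def fluxDensity (K : S.PartialCauchySurface) (f : ℝ → ℝ → ℝ) (X : Coord) (p : ℝ × ℝ × ℝ) : ℝ :=
  lift f (K.param p) * (volumeDensity S.metric (K.param p) *
    Matrix.det (Matrix.of ![X, fderiv ℝ K.param p (1, 0, 0), fderiv ℝ K.param p (0, 1, 0),
      fderiv ℝ K.param p (0, 0, 1)]))

/-- The integral `∫ f X^μ dΣ_μ` converges absolutely. -/
def FluxConverges (K : S.PartialCauchySurface) (f : ℝ → ℝ → ℝ) (X : Coord) : Prop :=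
  IntegrableOn (K.fluxDensity f X) (S.parameterDomain (Ioo 0 (2 * π)))

/-- The integral `∫ f X^μ dΣ_μ` over the surface. -/
def flux (K : S.PartialCauchySurface) (f : ℝ → ℝ → ℝ) (X : Coord) : ℝ :=
  ∫ p in S.parameterDomain (Ioo 0 (2 * π)), K.fluxDensity f X p

end PartialCauchySurface

end HartleThorne

/-- The `ℓ = 1` mode of a function of the polar angle, that is, the coefficient of
`P₁(cos θ) = cos θ` in its Legendre expansion. -/
def dipoleMode (μ : ℝ → ℝ) : ℝ := 3 / 2 * ∫ θ in (0 : ℝ)..π, μ θ * cos θ * sin θ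

end ScalarHair

end

open ScalarHair

noncomputable section

namespace ScalarHair

/-! On stationary, axisymmetric functions the wave operator times `√-g` is the divergence `∂_r (sin
θ r² E ∂_r f) + ∂_θ (sin θ D ∂_θ f)` with `E = N B² / A` and `D = N A` (`density_mul_dAlembertian`);
the rotation `ω` drops out. Mass centered coordinates give `E = 1 - 2M/r + O(r^{-2})` and `D = 1 +
O(r^{-2})`.

Local part. Inserting `f = r^{-k} (a + b/r + ...)` and comparing powers of `1/r` gives, with `L` the
Legendre operator, `L a + k(k-1) a = 0` and `L b + k(k+1) b = 2 M k² a` (`IsAMC.coeff_equations`).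
Regularity at the poles excludes the second solution of each equation. For `φ₀` (`k = -1`, `a = cos
θ`) this leaves `b = -M cos θ + const`, and the constant vanishes because `b` has the factor `cos
θ`. For `Φ` (`k = 1`) the source is too small to contribute, `a` is a constant `m`, and `b - M m` is
a regular `ℓ = 1` harmonic, hence a multiple `d cos θ`.

Global part. Green's identity for `φ₀` and `Φ` on a shell `r₁ < r < r₂` turns the integral of `-ε F
φ₀ √-g` into a difference of radial fluxes; the angular flux vanishes at the poles with `sin θ`. At
the horizon the radial flux tends to zero (`HasHorizon.bounds`): its coefficient `r² E` is a bounded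
density times the squared norm of the covector `r dr`, which vanishes on a null hypersurface. At
infinity the growing part of the flux is proportional to `cos θ sin θ` and integrates to zero, and
the finite part gives `-2 d` (`tendsto_flux_infinity`). Hence `d = (ε/2) ∫ F φ₀ √-g dr dθ`
(`dipole_eq_integral`).

The flux integrand on a surface is `F φ₀ √-g` times the derivative of `P - Ω T` along the closed
curves. That derivative integrates to `2π` for every surface and every `Ω`
(`integral_windingDensity`), so the flux is `2π` times the integral above (`flux_eq`). -/

/-! ### Calculus of functions of `(r, θ)` -/

variable {a : ℝ} {f g : ℝ → ℝ → ℝ} {m n : WithTop ℕ∞}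

/-- `f` is `n` times continuously differentiable at radii above `a`. -/
abbrev SmoothAbove (n : WithTop ℕ∞) (a : ℝ) (f : ℝ → ℝ → ℝ) : Prop :=
  ContDiffOn ℝ n (Function.uncurry f) (Ioi a ×ˢ univ)

theorem isOpen_above : IsOpen (Ioi a ×ˢ (univ : Set ℝ)) := isOpen_Ioi.prod isOpen_univ

theorem SmoothAbove.differentiableAt (h : SmoothAbove n a f) (hn : n ≠ 0) {r θ : ℝ} (hr : a < r) :
    DifferentiableAt ℝ (Function.uncurry f) (r, θ) :=
  (h.differentiableOn hn).differentiableAt (isOpen_above.mem_nhds ⟨hr, mem_univ _⟩)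

theorem hasDerivAt_radial_fderiv {r θ : ℝ} (h : DifferentiableAt ℝ (Function.uncurry f) (r, θ)) :
    HasDerivAt (fun s => f s θ) (fderiv ℝ (Function.uncurry f) (r, θ) (1, 0)) r := by
  have := h.hasFDerivAt.comp_hasDerivAt r ((hasDerivAt_id r).prodMk (hasDerivAt_const r θ))
  exact this

theorem hasDerivAt_angular_fderiv {r θ : ℝ} (h : DifferentiableAt ℝ (Function.uncurry f) (r, θ)) :
    HasDerivAt (f r) (fderiv ℝ (Function.uncurry f) (r, θ) (0, 1)) θ := by
  have := h.hasFDerivAt.comp_hasDerivAt θ ((hasDerivAt_const θ r).prodMk (hasDerivAt_id θ))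
  exact this

theorem SmoothAbove.hasDerivAt_radial (h : SmoothAbove n a f) (hn : n ≠ 0) {r θ : ℝ}
    (hr : a < r) : HasDerivAt (fun s => f s θ) (radialDeriv f r θ) r :=
  (hasDerivAt_radial_fderiv (h.differentiableAt hn hr)).differentiableAt.hasDerivAt

theorem SmoothAbove.hasDerivAt_angular (h : SmoothAbove n a f) (hn : n ≠ 0) {r θ : ℝ}
    (hr : a < r) : HasDerivAt (f r) (angularDeriv f r θ) θ :=
  (hasDerivAt_angular_fderiv (h.differentiableAt hn hr)).differentiableAt.hasDerivAt

theorem SmoothAbove.radialDeriv (h : SmoothAbove n a f) (hm : m + 1 ≤ n) :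
    SmoothAbove m a (radialDeriv f) := by
  have hn : n ≠ 0 := by rintro rfl; simp at hm
  refine ((h.fderiv_of_isOpen isOpen_above hm).clm_apply
    (contDiffOn_const (c := ((1 : ℝ), (0 : ℝ))))).congr ?_
  rintro ⟨r, θ⟩ ⟨hr, -⟩
  exact (hasDerivAt_radial_fderiv (h.differentiableAt hn hr)).deriv

theorem SmoothAbove.angularDeriv (h : SmoothAbove n a f) (hm : m + 1 ≤ n) :
    SmoothAbove m a (angularDeriv f) := by
  have hn : n ≠ 0 := by rintro rfl; simp at hm
  refine ((h.fderiv_of_isOpen isOpen_above hm).clm_apply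
    (contDiffOn_const (c := ((0 : ℝ), (1 : ℝ))))).congr ?_
  rintro ⟨r, θ⟩ ⟨hr, -⟩
  exact (hasDerivAt_angular_fderiv (h.differentiableAt hn hr)).deriv

theorem SmoothAbove.mul (hf : SmoothAbove n a f) (hg : SmoothAbove n a g) :
    SmoothAbove n a (fun r θ => f r θ * g r θ) := ContDiffOn.mul hf hg

theorem SmoothAbove.sub (hf : SmoothAbove n a f) (hg : SmoothAbove n a g) :
    SmoothAbove n a (fun r θ => f r θ - g r θ) := ContDiffOn.sub hf hg

theorem smoothAbove_sin : SmoothAbove n a (fun _ θ => sin θ) :=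
  (Real.contDiff_sin.comp contDiff_snd).contDiffOn

theorem smoothAbove_cos : SmoothAbove n a (fun _ θ => cos θ) :=
  (Real.contDiff_cos.comp contDiff_snd).contDiffOn

theorem smoothAbove_radius : SmoothAbove n a (fun r _ => r) := contDiff_fst.contDiffOn

theorem SmoothAbove.mono {b : ℝ} (hf : SmoothAbove n a f) (h : a ≤ b) : SmoothAbove n b f :=
  ContDiffOn.mono hf (prod_mono (Ioi_subset_Ioi h) subset_rfl)

theorem hasFDerivAt_lift {x : Coord} (h : DifferentiableAt ℝ (Function.uncurry f) (x 1, x 2)) :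
    HasFDerivAt (lift f) ((fderiv ℝ (Function.uncurry f) (x 1, x 2)).comp
      ((ContinuousLinearMap.proj (R := ℝ) (φ := fun _ : Fin 4 => ℝ) 1).prod
        (ContinuousLinearMap.proj (R := ℝ) (φ := fun _ : Fin 4 => ℝ) 2))) x := by
  have h1 := ((ContinuousLinearMap.proj (R := ℝ) (φ := fun _ : Fin 4 => ℝ) 1).prod
        (ContinuousLinearMap.proj (R := ℝ) (φ := fun _ : Fin 4 => ℝ) 2)).hasFDerivAt (x := x)
  exact HasFDerivAt.comp (g := Function.uncurry f) x h.hasFDerivAt h1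

theorem partialDeriv_lift {x : Coord} (h : DifferentiableAt ℝ (Function.uncurry f) (x 1, x 2)) :
    partialDeriv 0 (lift f) x = 0 ∧ partialDeriv 1 (lift f) x = radialDeriv f (x 1) (x 2) ∧
    partialDeriv 2 (lift f) x = angularDeriv f (x 1) (x 2) ∧ partialDeriv 3 (lift f) x = 0 := by
  have h1 : fderiv ℝ (Function.uncurry f) (x 1, x 2) (1, 0) = radialDeriv f (x 1) (x 2) :=
    (hasDerivAt_radial_fderiv h).deriv.symm
  have h2 : fderiv ℝ (Function.uncurry f) (x 1, x 2) (0, 1) = angularDeriv f (x 1) (x 2) :=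
    (hasDerivAt_angular_fderiv h).deriv.symm
  have h0 : ((0 : ℝ), (0 : ℝ)) = 0 := rfl
  simp [partialDeriv, (hasFDerivAt_lift h).fderiv, h1, h2, h0]

namespace HartleThorne

variable (S : HartleThorne)

/-! ### The wave operator on stationary, axisymmetric functions -/

/-- The combination `N B² / A`, in which the radial part of the wave operator is
`∂_r (r² (N B² / A) ∂_r)`. -/
def radialCoeff (r θ : ℝ) : ℝ := S.N r θ * S.B r θ ^ 2 * (S.A r θ)⁻¹

/-- The combination `N A`, in which the angular part of the wave operator is
`(1 / sin θ) ∂_θ (sin θ (N A) ∂_θ)`. -/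
def angularCoeff (r θ : ℝ) : ℝ := S.N r θ * S.A r θ

/-- The volume density as a function of `(r, θ)`. -/
def density (r θ : ℝ) : ℝ := S.N r θ * S.A r θ * r ^ 2 * S.B r θ ^ 2 * sin θ

theorem smoothAbove_radialCoeff : SmoothAbove 2 S.rH S.radialCoeff :=
  (S.N_regular.1.mul (S.B_regular.1.pow 2)).mul
    (S.A_regular.1.inv fun p hp => (S.A_pos p.1 hp.1 p.2).ne')

theorem smoothAbove_angularCoeff : SmoothAbove 2 S.rH S.angularCoeff :=
  S.N_regular.1.mul S.A_regular.1

theorem smoothAbove_density : SmoothAbove 2 S.rH S.density :=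
  (((S.N_regular.1.mul S.A_regular.1).mul (contDiff_fst.contDiffOn.pow 2)).mul
    (S.B_regular.1.pow 2)).mul smoothAbove_sin

theorem density_pos {r θ : ℝ} (hr : S.rH < r) (hθ : θ ∈ Ioo 0 π) : 0 < S.density r θ := by
  have := S.N_pos r hr θ
  have := S.A_pos r hr θ
  have := S.B_pos r hr θ
  have := S.rH_pos.trans hr
  have := sin_pos_of_mem_Ioo hθ
  unfold density
  positivity

theorem det_metric (x : Coord) : (S.metric x).det = -S.density (x 1) (x 2) ^ 2 := by
  simp [metric, density, Matrix.det_succ_row_zero, Fin.sum_univ_succ, Fin.succAbove]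
  ring

theorem volumeDensity_metric {x : Coord} (hx : x ∈ S.exterior) :
    volumeDensity S.metric x = S.density (x 1) (x 2) := by
  rw [volumeDensity, det_metric, neg_neg, Real.sqrt_sq (S.density_pos hx.1 hx.2).le]

/-- The inverse metric. -/
def inverseMetric (x : Coord) : Matrix (Fin 4) (Fin 4) ℝ :=
  let r := x 1
  let θ := x 2
  let N := S.N r θ
  let A := S.A r θ
  let B := S.B r θ
  let w := S.ω r θ
  !![-(1 / N ^ 2), 0, 0, -(w / N ^ 2);
     0, 1 / A ^ 2, 0, 0;
     0, 0, 1 / (r ^ 2 * B ^ 2), 0;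
     -(w / N ^ 2), 0, 0, 1 / (r ^ 2 * B ^ 2 * sin θ ^ 2) - w ^ 2 / N ^ 2]

theorem inv_metric {x : Coord} (hx : x ∈ S.exterior) : (S.metric x)⁻¹ = S.inverseMetric x := by
  have h1 := (S.N_pos _ hx.1 (x 2)).ne'
  have h2 := (S.A_pos _ hx.1 (x 2)).ne'
  have h3 := (S.B_pos _ hx.1 (x 2)).ne'
  have h4 := (S.rH_pos.trans hx.1).ne'
  have h5 := (sin_pos_of_mem_Ioo hx.2).ne'
  apply Matrix.inv_eq_right_inv
  ext i j
  fin_cases i <;> fin_cases j <;>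
    simp [metric, inverseMetric, Matrix.mul_apply, Fin.sum_univ_succ] <;> field_simp <;> ring

theorem isOpen_exterior : IsOpen S.exterior :=
  (isOpen_lt continuous_const (continuous_apply 1)).inter
    (isOpen_Ioo.preimage (continuous_apply 2))

/-- In the inverse metric `ω` occurs only in the components with both indices in `{t, φ}`, and these
meet derivatives that vanish. Multiplying by the density clears the factors `1 / sin θ`, so both
terms on the right make sense on the axis too. -/
theorem density_mul_dAlembertian (hf : SmoothAbove 2 S.rH f) {x : Coord} (hx : x ∈ S.exterior) :
    S.density (x 1) (x 2) * dAlembertian S.metric (lift f) x =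
      radialDeriv (fun r θ => sin θ * (r ^ 2 * S.radialCoeff r θ * radialDeriv f r θ))
        (x 1) (x 2) +
      angularDeriv (fun r θ => sin θ * (S.angularCoeff r θ * angularDeriv f r θ))
        (x 1) (x 2) := by
  have hr : SmoothAbove 1 S.rH
      (fun r θ => sin θ * (r ^ 2 * S.radialCoeff r θ * radialDeriv f r θ)) :=
    smoothAbove_sin.mul (((smoothAbove_radius.pow 2).mul
      (S.smoothAbove_radialCoeff.of_le one_le_two)).mul (hf.radialDeriv one_add_one_eq_two.le))
  have ha : SmoothAbove 1 S.rH
      (fun r θ => sin θ * (S.angularCoeff r θ * angularDeriv f r θ)) :=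
    smoothAbove_sin.mul ((S.smoothAbove_angularCoeff.of_le one_le_two).mul
      (hf.angularDeriv one_add_one_eq_two.le))
  -- The closed forms of the density and of the inverse metric hold only on the exterior; since it
  -- is open, they may be substituted under the outer derivative.
  have key : ∀ μ : Fin 4, ∀ F : Coord → ℝ, (∀ y ∈ S.exterior, volumeDensity S.metric y *
      ∑ ν, (S.metric y)⁻¹ μ ν * partialDeriv ν (lift f) y = F y) →
      partialDeriv μ (fun y => volumeDensity S.metric y *
        ∑ ν, (S.metric y)⁻¹ μ ν * partialDeriv ν (lift f) y) x = partialDeriv μ F x := by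
    intro μ F h
    rw [partialDeriv, partialDeriv, Filter.EventuallyEq.fderiv_eq]
    filter_upwards [S.isOpen_exterior.mem_nhds hx] with y hy using h y hy
  have comp : ∀ y ∈ S.exterior, ∀ μ : Fin 4, volumeDensity S.metric y *
      ∑ ν, (S.metric y)⁻¹ μ ν * partialDeriv ν (lift f) y = S.density (y 1) (y 2) *
      (S.inverseMetric y μ 1 * radialDeriv f (y 1) (y 2) +
        S.inverseMetric y μ 2 * angularDeriv f (y 1) (y 2)) := by
    intro y hy μ
    obtain ⟨h0, h1, h2, h3⟩ := partialDeriv_lift (hf.differentiableAt two_ne_zero hy.1)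
    rw [S.volumeDensity_metric hy, S.inv_metric hy, Fin.sum_univ_four, h0, h1, h2, h3]
    ring
  have k0 := key 0 (fun _ => 0) fun y hy => by
    rw [comp y hy]; simp [inverseMetric]
  have k3 := key 3 (fun _ => 0) fun y hy => by
    rw [comp y hy]; simp [inverseMetric]
  have k1 := key 1 (lift fun r θ => sin θ * (r ^ 2 * S.radialCoeff r θ * radialDeriv f r θ))
    fun y hy => by
      have := (S.A_pos _ hy.1 (y 2)).ne'
      rw [comp y hy]; simp [inverseMetric, lift, density, radialCoeff]; field_simp
  have k2 := key 2 (lift fun r θ => sin θ * (S.angularCoeff r θ * angularDeriv f r θ))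
    fun y hy => by
      have := (S.B_pos _ hy.1 (y 2)).ne'
      have := (S.rH_pos.trans hy.1).ne'
      rw [comp y hy]; simp [inverseMetric, lift, density, angularCoeff]; field_simp
  rw [dAlembertian, Fin.sum_univ_four, k0, k1, k2, k3,
    (partialDeriv_lift (hr.differentiableAt one_ne_zero hx.1)).2.1,
    (partialDeriv_lift (ha.differentiableAt one_ne_zero hx.1)).2.2.1, S.volumeDensity_metric hx]
  have := (S.density_pos hx.1 hx.2).ne'
  simp only [partialDeriv, fderiv_fun_const, Pi.zero_apply, zero_apply]
  field_simp
  ring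

end HartleThorne
end ScalarHair

namespace ScalarHair

/-! ### Expansions in powers of `1/r` -/

open Asymptotics

/-- The filter `r → ∞`, uniformly in the polar angle. -/
def infinity : Filter (ℝ × ℝ) := atTop ×ˢ 𝓟 (Ioo 0 π)

theorem eventually_infinity {P : ℝ → ℝ → Prop} :
    (∀ᶠ p in infinity, P p.1 p.2) ↔ ∀ᶠ r in atTop, ∀ θ ∈ Ioo 0 π, P r θ := by
  rw [infinity, eventually_prod_principal_iff]

theorem eventually_infinity_gt (R : ℝ) : ∀ᶠ p in infinity, R < p.1 ∧ p.2 ∈ Ioo 0 π :=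
  eventually_infinity (P := fun r θ => R < r ∧ θ ∈ Ioo 0 π).2
    ((eventually_gt_atTop R).mono fun _ hr _ hθ => ⟨hr, hθ⟩)

theorem tendsto_infinity {θ : ℝ} (hθ : θ ∈ Ioo 0 π) :
    Tendsto (fun r : ℝ => (r, θ)) atTop infinity :=
  tendsto_id.prodMk (tendsto_principal.2 (Eventually.of_forall fun _ => hθ))

theorem isBigO_infinity {f : ℝ → ℝ → ℝ} {n : ℕ} {R C : ℝ}
    (h : ∀ r, R < r → ∀ θ ∈ Ioo 0 π, |f r θ| ≤ C / r ^ n) :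
    (fun p : ℝ × ℝ => f p.1 p.2) =O[infinity] fun p => p.1⁻¹ ^ n := by
  refine IsBigO.of_bound C ?_
  filter_upwards [eventually_infinity_gt R, eventually_infinity_gt 0] with p hp hp'
  have := inv_pos.2 hp'.1
  rw [norm_eq_abs, norm_of_nonneg (by positivity), inv_pow, ← div_eq_mul_inv]
  exact h p.1 hp.1 p.2 hp.2

theorem isBigO_inv_infinity : (fun p : ℝ × ℝ => p.1⁻¹) =O[infinity] fun _ => (1 : ℝ) := by
  have : Tendsto (fun p : ℝ × ℝ => p.1⁻¹) infinity (𝓝 0) :=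
    tendsto_inv_atTop_zero.comp tendsto_fst
  exact this.isBigO_one ℝ

theorem isBigO_angle {a : ℝ → ℝ} (ha : Continuous a) :
    (fun p : ℝ × ℝ => a p.2) =O[infinity] fun _ => (1 : ℝ) := by
  obtain ⟨C, hC⟩ := isCompact_Icc.exists_bound_of_continuousOn (s := Icc 0 π) ha.continuousOn
  refine IsBigO.of_bound C ?_
  filter_upwards [eventually_infinity_gt 0] with p hp
  simpa using hC _ (Ioo_subset_Icc_self hp.2)

/-- Uniqueness of the first two coefficients of an expansion: the limit `r → ∞` gives `u = 0`, and
after multiplication by `r` the same limit gives `v = 0`. -/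
theorem eq_zero_of_isBigO_inv_sq {u v : ℝ}
    (h : (fun r : ℝ => u + v * r⁻¹) =O[atTop] fun r => r⁻¹ ^ 2) : u = 0 ∧ v = 0 := by
  have hx : Tendsto (fun r : ℝ => r⁻¹) atTop (𝓝 0) := tendsto_inv_atTop_zero
  have h1 : Tendsto (fun r : ℝ => u + v * r⁻¹) atTop (𝓝 0) :=
    h.trans_tendsto (by simpa using hx.pow 2)
  have hu : u = 0 := tendsto_nhds_unique (by simpa using (hx.const_mul v).const_add u) h1
  refine ⟨hu, ?_⟩
  subst hu
  have h2 : (fun r : ℝ => r * (0 + v * r⁻¹)) =O[atTop] fun r => r * r⁻¹ ^ 2 :=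
    (isBigO_refl _ _).mul h
  have h3 : (fun _ : ℝ => v) =O[atTop] fun r : ℝ => r⁻¹ := by
    refine h2.congr' ?_ ?_ <;> filter_upwards [eventually_gt_atTop 0] with r hr <;> field_simp
    ring
  exact tendsto_nhds_unique tendsto_const_nhds (h3.trans_tendsto hx)

/-- `f = a(θ) + b(θ)/r + O(r^{-2})` as `r → ∞`, uniformly in the polar angle. -/
structure HasExpansion (f : ℝ → ℝ → ℝ) (a b : ℝ → ℝ) : Prop where
  continuous_fst : Continuous a
  continuous_snd : Continuous b
  isBigO : (fun p : ℝ × ℝ => f p.1 p.2 - (a p.2 + b p.2 * p.1⁻¹)) =O[infinity]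
    fun p => p.1⁻¹ ^ 2

namespace HasExpansion

variable {f g : ℝ → ℝ → ℝ} {a b c d : ℝ → ℝ}

theorem principal_isBigO_one (ha : Continuous a) (hb : Continuous b) :
    (fun p : ℝ × ℝ => a p.2 + b p.2 * p.1⁻¹) =O[infinity] fun _ => (1 : ℝ) :=
  (isBigO_angle ha).add (by simpa using (isBigO_angle hb).mul isBigO_inv_infinity)

theorem isBigO_one (h : HasExpansion f a b) :
    (fun p : ℝ × ℝ => f p.1 p.2) =O[infinity] fun _ => (1 : ℝ) := by
  have h1 := (h.isBigO.trans (by simpa using isBigO_inv_infinity.pow 2)).add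
    (principal_isBigO_one h.1 h.2)
  exact h1.congr_left fun p => by ring

theorem congr (h : HasExpansion f a b)
    (hfg : ∀ᶠ p in infinity, f p.1 p.2 = g p.1 p.2) : HasExpansion g a b :=
  ⟨h.1, h.2, h.3.congr' (hfg.mono fun p hp => by simp only [hp]) EventuallyEq.rfl⟩

theorem of_angle (ha : Continuous a) : HasExpansion (fun _ θ => a θ) a (fun _ => 0) :=
  ⟨ha, continuous_const, (isBigO_zero _ _).congr_left fun p => by ring⟩

theorem add (hf : HasExpansion f a b) (hg : HasExpansion g c d) :
    HasExpansion (fun r θ => f r θ + g r θ) (fun θ => a θ + c θ) (fun θ => b θ + d θ) :=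
  ⟨hf.1.add hg.1, hf.2.add hg.2, (hf.3.add hg.3).congr_left fun p => by ring⟩

theorem mul (hf : HasExpansion f a b) (hg : HasExpansion g c d) :
    HasExpansion (fun r θ => f r θ * g r θ) (fun θ => a θ * c θ)
      (fun θ => a θ * d θ + b θ * c θ) := by
  refine ⟨hf.1.mul hg.1, (hf.1.mul hg.2).add (hf.2.mul hg.1), ?_⟩
  have h1 := hf.3.mul hg.isBigO_one
  have h2 := (principal_isBigO_one hf.1 hf.2).mul hg.3
  have h3 := (isBigO_angle (hf.2.mul hg.2)).mul (isBigO_refl (fun p : ℝ × ℝ => p.1⁻¹ ^ 2) infinity)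
  simp only [one_mul, mul_one, Pi.mul_apply] at h1 h2 h3
  exact ((h1.add h2).add h3).congr_left fun p => by ring

theorem const_mul (k : ℝ) (hf : HasExpansion f a b) :
    HasExpansion (fun r θ => k * f r θ) (fun θ => k * a θ) (fun θ => k * b θ) :=
  ⟨hf.1.const_mul k, hf.2.const_mul k, (hf.3.const_mul_left k).congr_left fun p => by ring⟩

theorem sub (hf : HasExpansion f a b) (hg : HasExpansion g c d) :
    HasExpansion (fun r θ => f r θ - g r θ) (fun θ => a θ - c θ) (fun θ => b θ - d θ) :=
  ⟨hf.1.sub hg.1, hf.2.sub hg.2, (hf.3.sub hg.3).congr_left fun p => by ring⟩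

theorem coeff_eq (hf : HasExpansion f a b) (ha : ∀ θ, a θ = c θ) (hb : ∀ θ, b θ = d θ) :
    HasExpansion f c d := by
  obtain rfl := funext ha
  obtain rfl := funext hb
  exact hf

/-- One has `1/f - (1 - m/r) = -(1/f) (f (1 - m/r) - 1)`. The factor `1/f` is bounded since `f → 1`,
and the product rule gives `f (1 - m/r)` the coefficients `1` and `0`. -/
theorem inv {m : ℝ} (hf : HasExpansion f (fun _ => 1) (fun _ => m)) :
    HasExpansion (fun r θ => (f r θ)⁻¹) (fun _ => 1) (fun _ => -m) := by
  refine ⟨continuous_const, continuous_const, ?_⟩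
  have hx : Tendsto (fun p : ℝ × ℝ => p.1⁻¹) infinity (𝓝 0) :=
    tendsto_inv_atTop_zero.comp tendsto_fst
  have h1 : Tendsto (fun p : ℝ × ℝ => f p.1 p.2) infinity (𝓝 1) := by
    have h2 := hf.3.trans_tendsto (by simpa using hx.pow 2)
    have h3 : Tendsto (fun p : ℝ × ℝ => 1 + m * p.1⁻¹) infinity (𝓝 1) := by
      simpa using (hx.const_mul m).const_add 1
    simpa using h2.add h3
  have hinv := (h1.inv₀ one_ne_zero).isBigO_one ℝ
  have h4 := (hf.mul (⟨continuous_const, continuous_const, (isBigO_zero _ _).congr_left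
    fun p => by ring⟩ : HasExpansion (fun r _ => 1 + -m * r⁻¹) (fun _ => 1) fun _ => -m)).3
  have h5 := (hinv.mul h4).neg_left
  simp only [one_mul] at h5
  refine h5.congr' ?_ EventuallyEq.rfl
  filter_upwards [h1.eventually_ne one_ne_zero] with p hp
  field_simp
  ring

theorem coeff_eq_zero (hf : HasExpansion f a b)
    (h0 : (fun p : ℝ × ℝ => f p.1 p.2) =O[infinity] fun p => p.1⁻¹ ^ 2)
    {θ : ℝ} (hθ : θ ∈ Ioo 0 π) : a θ = 0 ∧ b θ = 0 := by
  have h1 := (h0.sub hf.3).comp_tendsto (tendsto_infinity hθ)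
  exact eq_zero_of_isBigO_inv_sq (h1.congr_left fun r => by simp)

end HasExpansion

/-! ### Decay of remainders and term by term differentiation -/

/-- A function with the decay of a remainder of order `r^{-p}` for the derivatives that occur in
the wave operator. -/
structure DecaysLike (p : ℕ) (f : ℝ → ℝ → ℝ) : Prop where
  smooth : ∃ R, SmoothAbove 2 R f
  self : (fun q : ℝ × ℝ => f q.1 q.2) =O[infinity] fun q => q.1⁻¹ ^ p
  radial : (fun q : ℝ × ℝ => radialDeriv f q.1 q.2) =O[infinity] fun q => q.1⁻¹ ^ (p + 1)
  radial₂ : (fun q : ℝ × ℝ => radialDeriv (radialDeriv f) q.1 q.2) =O[infinity]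
    fun q => q.1⁻¹ ^ (p + 2)
  angular : (fun q : ℝ × ℝ => angularDeriv f q.1 q.2) =O[infinity] fun q => q.1⁻¹ ^ p
  angular₂ : (fun q : ℝ × ℝ => angularDeriv (angularDeriv f) q.1 q.2) =O[infinity]
    fun q => q.1⁻¹ ^ p

theorem IsRemainder.decaysLike {p : ℕ} {f : ℝ → ℝ → ℝ} (h : IsRemainder p f) :
    DecaysLike p f := by
  obtain ⟨R, C, -, hs, hb⟩ := h
  exact ⟨⟨R, hs⟩,
    isBigO_infinity fun r hr θ _ => hb r hr θ 0 0 (by simp),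
    isBigO_infinity fun r hr θ _ => hb r hr θ 1 0 (by simp),
    isBigO_infinity fun r hr θ _ => hb r hr θ 2 0 (by simp),
    isBigO_infinity fun r hr θ _ => hb r hr θ 0 1 (by simp),
    isBigO_infinity fun r hr θ _ => hb r hr θ 0 2 (by simp)⟩

theorem IsRemainder.isBigO_atTop {p : ℕ} {f : ℝ → ℝ → ℝ} (h : IsRemainder p f) (θ : ℝ) :
    (fun r => f r θ) =O[atTop] fun r => r⁻¹ ^ p := by
  obtain ⟨R, C, -, -, hb⟩ := h
  refine IsBigO.of_bound C ?_
  filter_upwards [eventually_gt_atTop R, eventually_gt_atTop 0] with r hr h0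
  rw [norm_eq_abs, norm_of_nonneg (by positivity), inv_pow, ← div_eq_mul_inv]
  exact hb r hr θ 0 0 (by simp)

/-- Equality above some radius passes to the radial derivative. -/
theorem radialDeriv_congr {f g : ℝ → ℝ → ℝ} {R : ℝ} (h : ∀ r, R < r → ∀ θ, f r θ = g r θ)
    {r θ : ℝ} (hr : R < r) : radialDeriv f r θ = radialDeriv g r θ :=
  Filter.EventuallyEq.deriv_eq ((eventually_gt_nhds hr).mono fun s hs => h s hs θ)

theorem angularDeriv_congr {f g : ℝ → ℝ → ℝ} {R : ℝ} (h : ∀ r, R < r → ∀ θ, f r θ = g r θ)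
    {r θ : ℝ} (hr : R < r) : angularDeriv f r θ = angularDeriv g r θ := by
  rw [angularDeriv, angularDeriv, funext (h r hr)]

/-- Needed for `φ₀`, whose remainder is given relative to the prefactor `r cos θ`. By the Leibniz
rule the factor `r` costs exactly one order in each derivative, and `cos θ` and its derivatives are
bounded. -/
theorem DecaysLike.mul_radius_cos {p : ℕ} {f : ℝ → ℝ → ℝ} (h : DecaysLike (p + 1) f) :
    DecaysLike p (fun r θ => r * cos θ * f r θ) := by
  obtain ⟨R, hs⟩ := h.smooth
  have h2 : (2 : WithTop ℕ∞) ≠ 0 := two_ne_zero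
  have hs' : SmoothAbove 2 R (fun r θ => r * cos θ * f r θ) :=
    (smoothAbove_radius.mul smoothAbove_cos).mul hs
  have hr1 := hs.radialDeriv one_add_one_eq_two.le
  have ha1 := hs.angularDeriv one_add_one_eq_two.le
  have er : ∀ r, R < r → ∀ θ, radialDeriv (fun r θ => r * cos θ * f r θ) r θ =
      cos θ * f r θ + r * cos θ * radialDeriv f r θ := fun r hr θ => by
    have := (((hasDerivAt_id r).mul_const (cos θ)).mul (hs.hasDerivAt_radial h2 hr (θ := θ))).deriv
    simp only [id, one_mul] at this
    exact this
  have ea : ∀ r, R < r → ∀ θ, angularDeriv (fun r θ => r * cos θ * f r θ) r θ =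
      r * (cos θ * angularDeriv f r θ - sin θ * f r θ) := fun r hr θ => by
    have := (((hasDerivAt_cos θ).const_mul r).mul (hs.hasDerivAt_angular h2 hr (θ := θ))).deriv
    refine Eq.trans this ?_
    ring
  have er2 : ∀ r, R < r → ∀ θ, radialDeriv (radialDeriv (fun r θ => r * cos θ * f r θ)) r θ =
      cos θ * (2 * radialDeriv f r θ + r * radialDeriv (radialDeriv f) r θ) := fun r hr θ => by
    rw [radialDeriv_congr er hr]
    have := (((hs.hasDerivAt_radial h2 hr (θ := θ)).const_mul (cos θ)).add
      (((hasDerivAt_id r).mul_const (cos θ)).mul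
        (hr1.hasDerivAt_radial one_ne_zero hr (θ := θ)))).deriv
    refine Eq.trans this ?_
    simp only [id]
    ring
  have ea2 : ∀ r, R < r → ∀ θ, angularDeriv (angularDeriv (fun r θ => r * cos θ * f r θ)) r θ =
      r * (cos θ * angularDeriv (angularDeriv f) r θ - 2 * (sin θ * angularDeriv f r θ)
        - cos θ * f r θ) := fun r hr θ => by
    rw [angularDeriv_congr ea hr]
    have := ((((hasDerivAt_cos θ).mul (ha1.hasDerivAt_angular one_ne_zero hr (θ := θ))).sub
      ((hasDerivAt_sin θ).mul (hs.hasDerivAt_angular h2 hr (θ := θ)))).const_mul r).deriv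
    refine Eq.trans this ?_
    ring
  have hcos := isBigO_angle continuous_cos
  have hsin := isBigO_angle continuous_sin
  have hx : ∀ n : ℕ, (fun q : ℝ × ℝ => q.1 * q.1⁻¹ ^ (n + 1)) =ᶠ[infinity] fun q => q.1⁻¹ ^ n := by
    intro n
    filter_upwards [eventually_infinity_gt 0] with q hq
    have := hq.1.ne'
    rw [pow_succ]
    field_simp
  have hmul : ∀ {n : ℕ} {g : ℝ × ℝ → ℝ}, g =O[infinity] (fun q => q.1⁻¹ ^ (n + 1)) →
      (fun q => q.1 * g q) =O[infinity] fun q => q.1⁻¹ ^ n := fun {n g} hg =>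
    ((isBigO_refl (fun q : ℝ × ℝ => q.1) infinity).mul hg).congr' EventuallyEq.rfl (hx n)
  have hang : ∀ {n : ℕ} {a : ℝ × ℝ → ℝ} {g : ℝ × ℝ → ℝ}, a =O[infinity] (fun _ => (1 : ℝ)) →
      g =O[infinity] (fun q => q.1⁻¹ ^ n) →
      (fun q => a q * g q) =O[infinity] fun q => q.1⁻¹ ^ n := fun ha hg => by
    simpa using ha.mul hg
  have hR := eventually_infinity_gt R
  refine ⟨⟨R, hs'⟩, ?_, ?_, ?_, ?_, ?_⟩
  · exact (hmul (hang hcos h.self)).congr_left fun q => by ring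
  · refine ((hang hcos h.self).add (hmul (hang hcos h.radial))).congr' ?_ EventuallyEq.rfl
    filter_upwards [hR] with q hq
    rw [er _ hq.1]; ring
  · refine (hang hcos ((h.radial.const_mul_left 2).add (hmul h.radial₂))).congr' ?_ EventuallyEq.rfl
    filter_upwards [hR] with q hq
    rw [er2 _ hq.1]
  · refine (hmul ((hang hcos h.angular).sub (hang hsin h.self))).congr' ?_ EventuallyEq.rfl
    filter_upwards [hR] with q hq
    rw [ea _ hq.1]
  · refine (hmul (((hang hcos h.angular₂).sub ((hang hsin h.angular).const_mul_left 2)).sub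
      (hang hcos h.self))).congr' ?_ EventuallyEq.rfl
    filter_upwards [hR] with q hq
    rw [ea2 _ hq.1]

/-- The expansions `f = r^{-k} (a + b/r + O(r^{-2}))` and its term by term derivatives. -/
structure HasFieldExpansion (k : ℤ) (f : ℝ → ℝ → ℝ) (a b : ℝ → ℝ) : Prop where
  self : HasExpansion (fun r θ => r ^ k * f r θ) a b
  radial : HasExpansion (fun r θ => r ^ k * (r * radialDeriv f r θ)) (fun θ => -k * a θ)
    fun θ => -(k + 1) * b θ
  radial₂ : HasExpansion (fun r θ => r ^ k * (r ^ 2 * radialDeriv (radialDeriv f) r θ))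
    (fun θ => k * (k + 1) * a θ) fun θ => (k + 1) * (k + 2) * b θ
  angular : HasExpansion (fun r θ => r ^ k * angularDeriv f r θ) (deriv a) (deriv b)
  angular₂ : HasExpansion (fun r θ => r ^ k * angularDeriv (angularDeriv f) r θ)
    (deriv (deriv a)) (deriv (deriv b))

/-- The condition `p = k + 2` places the remainder two orders below the leading term `r^{-k} a`. The
coefficients in `HasFieldExpansion` come from differentiating `r^{-k}` and `r^{-k-1}`. -/
theorem DecaysLike.hasFieldExpansion {k : ℤ} {p : ℕ} (hp : (p : ℤ) = k + 2) {ρ f : ℝ → ℝ → ℝ}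
    (hρ : DecaysLike p ρ) {a b : ℝ → ℝ} (ha : ContDiff ℝ 2 a) (hb : ContDiff ℝ 2 b) {R : ℝ}
    (hf : ∀ r, R < r → ∀ θ, f r θ = r ^ (-k) * a θ + r ^ (-k - 1) * b θ + ρ r θ) :
    HasFieldExpansion k f a b := by
  obtain ⟨R₀, hs⟩ := hρ.smooth
  obtain ⟨R₁, h01, h1, h11⟩ : ∃ R₁, R ≤ R₁ ∧ R₀ ≤ R₁ ∧ 0 ≤ R₁ :=
    ⟨max R (max R₀ 0), by simp, by simp, by simp⟩
  have h2 : (2 : WithTop ℕ∞) ≠ 0 := two_ne_zero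
  replace hs := hs.mono h1
  replace hf : ∀ r, R₁ < r → ∀ θ, f r θ = r ^ (-k) * a θ + r ^ (-k - 1) * b θ + ρ r θ :=
    fun r hr θ => hf r (h01.trans_lt hr) θ
  have ha1 : ContDiff ℝ 1 (deriv a) := ContDiff.deriv' ha
  have hb1 : ContDiff ℝ 1 (deriv b) := ContDiff.deriv' hb
  have ha2 : Continuous (deriv (deriv a)) := ha1.continuous_deriv_one
  have hb2 : Continuous (deriv (deriv b)) := hb1.continuous_deriv_one
  have hr1 := hs.radialDeriv one_add_one_eq_two.le
  have hρ1 := hs.angularDeriv one_add_one_eq_two.le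
  have er : ∀ r, R₁ < r → ∀ θ, radialDeriv f r θ =
      -k * r ^ (-k - 1) * a θ + (-k - 1) * r ^ (-k - 1 - 1) * b θ + radialDeriv ρ r θ :=
    fun r hr θ => by
    have h0 := (h11.trans_lt hr).ne'
    rw [radialDeriv_congr hf hr]
    have := ((((hasDerivAt_zpow (-k) r (.inl h0)).mul_const (a θ)).add
      ((hasDerivAt_zpow (-k - 1) r (.inl h0)).mul_const (b θ))).add
        (hs.hasDerivAt_radial h2 hr (θ := θ))).deriv
    refine Eq.trans this ?_
    push_cast
    ring
  have er2 : ∀ r, R₁ < r → ∀ θ, radialDeriv (radialDeriv f) r θ =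
      k * (k + 1) * r ^ (-k - 1 - 1) * a θ + (k + 1) * (k + 2) * r ^ (-k - 1 - 1 - 1) * b θ +
        radialDeriv (radialDeriv ρ) r θ :=
    fun r hr θ => by
    have h0 := (h11.trans_lt hr).ne'
    rw [radialDeriv_congr er hr]
    have := (((((hasDerivAt_zpow (-k - 1) r (.inl h0)).const_mul (-k : ℝ)).mul_const (a θ)).add
      (((hasDerivAt_zpow (-k - 1 - 1) r (.inl h0)).const_mul (-k - 1 : ℝ)).mul_const (b θ))).add
        (hr1.hasDerivAt_radial one_ne_zero hr (θ := θ))).deriv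
    refine Eq.trans this ?_
    push_cast
    ring
  have ea : ∀ r, R₁ < r → ∀ θ, angularDeriv f r θ =
      r ^ (-k) * deriv a θ + r ^ (-k - 1) * deriv b θ + angularDeriv ρ r θ := fun r hr θ => by
    rw [angularDeriv_congr hf hr]
    exact ((((ha.differentiable h2 θ).hasDerivAt.const_mul _).add
      ((hb.differentiable h2 θ).hasDerivAt.const_mul _)).add
        (hs.hasDerivAt_angular h2 hr (θ := θ))).deriv
  have ea2 : ∀ r, R₁ < r → ∀ θ, angularDeriv (angularDeriv f) r θ =
      r ^ (-k) * deriv (deriv a) θ + r ^ (-k - 1) * deriv (deriv b) θ +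
        angularDeriv (angularDeriv ρ) r θ := fun r hr θ => by
    rw [angularDeriv_congr ea hr]
    exact ((((ha1.differentiable one_ne_zero θ).hasDerivAt.const_mul _).add
      ((hb1.differentiable one_ne_zero θ).hasDerivAt.const_mul _)).add
        (hρ1.hasDerivAt_angular one_ne_zero hr (θ := θ))).deriv
  have hR := eventually_infinity_gt R₁
  -- The weight `r^k r^n`, with `n` the number of radial derivatives, brings every remainder to the
  -- common order `r^{-2}`.
  have hmul : ∀ {n : ℕ} {g : ℝ × ℝ → ℝ}, g =O[infinity] (fun q => q.1⁻¹ ^ (p + n)) →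
      (fun q => q.1 ^ k * (q.1 ^ n * g q)) =O[infinity] fun q => q.1⁻¹ ^ 2 := by
    intro n g hg
    refine ((isBigO_refl (fun q : ℝ × ℝ => q.1 ^ k * q.1 ^ n) infinity).mul hg).congr'
      (Eventually.of_forall fun q => by ring) ?_
    filter_upwards [hR] with q hq
    have h0 := (h11.trans_lt hq.1).ne'
    rw [pow_add, ← zpow_natCast q.1⁻¹ p, hp, inv_zpow', neg_add, zpow_add₀ h0, zpow_neg]
    have := zpow_ne_zero k h0
    field_simp
    simp
    field_simp
  have e1 : ∀ {r : ℝ}, r ≠ 0 → r ^ k * r ^ (-k) = 1 := fun h0 => by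
    rw [← zpow_add₀ h0]; simp
  refine ⟨⟨ha.continuous, hb.continuous, ?_⟩,
    ⟨ha.continuous.const_mul _, hb.continuous.const_mul _, ?_⟩,
    ⟨ha.continuous.const_mul _, hb.continuous.const_mul _, ?_⟩,
    ⟨ha1.continuous, hb1.continuous, ?_⟩, ⟨ha2, hb2, ?_⟩⟩
  · refine (hmul (n := 0) hρ.self).congr' ?_ EventuallyEq.rfl
    filter_upwards [hR] with q hq
    have h0 := (h11.trans_lt hq.1).ne'
    rw [hf _ hq.1, zpow_sub_one₀ h0]
    linear_combination (- a q.2 - b q.2 * q.1⁻¹) * e1 h0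
  · refine (hmul (n := 1) hρ.radial).congr' ?_ EventuallyEq.rfl
    filter_upwards [hR] with q hq
    have h0 := (h11.trans_lt hq.1).ne'
    simp only [er _ hq.1, zpow_sub_one₀ h0]
    field_simp
    linear_combination (k * q.1 * a q.2 + (k + 1) * b q.2) * e1 h0
  · refine (hmul (n := 2) hρ.radial₂).congr' ?_ EventuallyEq.rfl
    filter_upwards [hR] with q hq
    have h0 := (h11.trans_lt hq.1).ne'
    simp only [er2 _ hq.1, zpow_sub_one₀ h0]
    field_simp
    linear_combination (- k * q.1 * (k + 1) * a q.2 - (k + 1) * (k + 2) * b q.2) * e1 h0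
  · refine (hmul (n := 0) hρ.angular).congr' ?_ EventuallyEq.rfl
    filter_upwards [hR] with q hq
    have h0 := (h11.trans_lt hq.1).ne'
    rw [ea _ hq.1, zpow_sub_one₀ h0]
    linear_combination (- deriv a q.2 - deriv b q.2 * q.1⁻¹) * e1 h0
  · refine (hmul (n := 0) hρ.angular₂).congr' ?_ EventuallyEq.rfl
    filter_upwards [hR] with q hq
    have h0 := (h11.trans_lt hq.1).ne'
    rw [ea2 _ hq.1, zpow_sub_one₀ h0]
    linear_combination (- deriv (deriv a) q.2 - deriv (deriv b) q.2 * q.1⁻¹) * e1 h0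

end ScalarHair

namespace ScalarHair

open Asymptotics

/-! ### The equations for the leading coefficients -/

namespace HartleThorne

variable {S : HartleThorne} {M J : ℝ}

theorem IsAMC.N_expansion (h : S.IsAMC M J) :
    HasFieldExpansion 0 S.N (fun _ => 1) fun _ => -M :=
  h.1.decaysLike.hasFieldExpansion (by norm_num) contDiff_const contDiff_const (R := 0)
    fun r hr θ => by simp [zpow_neg]; ring

theorem IsAMC.A_expansion (h : S.IsAMC M J) :
    HasFieldExpansion 0 S.A (fun _ => 1) fun _ => M :=
  h.2.1.decaysLike.hasFieldExpansion (by norm_num) contDiff_const contDiff_const (R := 0)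
    fun r hr θ => by simp [zpow_neg]; ring

theorem IsAMC.B_expansion (h : S.IsAMC M J) :
    HasFieldExpansion 0 S.B (fun _ => 1) fun _ => 0 :=
  h.2.2.1.decaysLike.hasFieldExpansion (by norm_num) contDiff_const contDiff_const (R := 0)
    fun r hr θ => by simp

/-- `N` and `1/A` contribute `-M` each and `B` nothing; in `angularCoeff` the contributions of `N`
and `A` cancel. -/
theorem IsAMC.radialCoeff_expansion (h : S.IsAMC M J) :
    HasExpansion S.radialCoeff (fun _ => 1) fun _ => -2 * M := by
  have hN := h.N_expansion.self
  have hA := h.A_expansion.self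
  have hB := h.B_expansion.self
  simp only [zpow_zero, one_mul] at hN hA hB
  exact (((hN.mul (hB.mul hB)).mul hA.inv).coeff_eq (fun θ => by ring) (fun θ => by ring)).congr
    (Eventually.of_forall fun p => by rw [radialCoeff]; ring)

theorem radialDeriv_radialCoeff {r θ : ℝ} (hr : S.rH < r) :
    radialDeriv S.radialCoeff r θ = radialDeriv S.N r θ * S.B r θ ^ 2 * (S.A r θ)⁻¹ +
      S.N r θ * (2 * S.B r θ * radialDeriv S.B r θ) * (S.A r θ)⁻¹ -
      S.N r θ * S.B r θ ^ 2 * (radialDeriv S.A r θ * ((S.A r θ)⁻¹ * (S.A r θ)⁻¹)) := by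
  have h2 : (2 : WithTop ℕ∞) ≠ 0 := two_ne_zero
  have hA := (S.A_pos r hr θ).ne'
  have := (((SmoothAbove.hasDerivAt_radial S.N_regular.1 h2 hr (θ := θ)).mul
    ((SmoothAbove.hasDerivAt_radial S.B_regular.1 h2 hr (θ := θ)).pow 2)).mul
    ((SmoothAbove.hasDerivAt_radial S.A_regular.1 h2 hr (θ := θ)).fun_inv hA)).deriv
  refine Eq.trans this ?_
  simp
  field_simp
  ring

theorem IsAMC.radialDeriv_radialCoeff_expansion (h : S.IsAMC M J) :
    HasExpansion (fun r θ => r * radialDeriv S.radialCoeff r θ) (fun _ => 0)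
      fun _ => 2 * M := by
  have hN := h.N_expansion.self
  have hA := h.A_expansion.self
  have hB := h.B_expansion.self
  have hN1 := h.N_expansion.radial
  have hA1 := h.A_expansion.radial
  have hB1 := h.B_expansion.radial
  simp only [zpow_zero, one_mul] at hN hA hB hN1 hA1 hB1
  refine (((((hN1.mul (hB.mul hB)).mul hA.inv).add
    ((hN.mul ((hB.mul hB1).const_mul 2)).mul hA.inv)).sub
      ((hN.mul (hB.mul hB)).mul (hA1.mul (hA.inv.mul hA.inv)))).coeff_eq (fun θ => by simp)
      (fun θ => by simp; ring)).congr ?_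
  filter_upwards [eventually_infinity_gt S.rH] with p hp
  rw [radialDeriv_radialCoeff hp.1]
  ring

theorem IsAMC.angularCoeff_expansion (h : S.IsAMC M J) :
    HasExpansion S.angularCoeff (fun _ => 1) fun _ => 0 := by
  have hN := h.N_expansion.self
  have hA := h.A_expansion.self
  simp only [zpow_zero, one_mul] at hN hA
  exact (hN.mul hA).coeff_eq (fun θ => by ring) (fun θ => by ring)

theorem IsAMC.angularDeriv_angularCoeff_expansion (h : S.IsAMC M J) :
    HasExpansion (angularDeriv S.angularCoeff) (fun _ => 0) fun _ => 0 := by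
  have hN := h.N_expansion.self
  have hA := h.A_expansion.self
  have hN1 := h.N_expansion.angular
  have hA1 := h.A_expansion.angular
  simp only [zpow_zero, one_mul, deriv_const'] at hN hA hN1 hA1
  refine (((hN1.mul hA).add (hN.mul hA1)).coeff_eq (fun θ => by ring) (fun θ => by ring)).congr ?_
  filter_upwards [eventually_infinity_gt S.rH] with p hp
  have h2 : (2 : WithTop ℕ∞) ≠ 0 := two_ne_zero
  exact ((SmoothAbove.hasDerivAt_angular S.N_regular.1 h2 hp.1 (θ := p.2)).mul
    (SmoothAbove.hasDerivAt_angular S.A_regular.1 h2 hp.1 (θ := p.2))).deriv.symm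

theorem IsAMC.density_isBigO (h : S.IsAMC M J) :
    (fun p : ℝ × ℝ => S.density p.1 p.2) =O[infinity] fun p => p.1 ^ 2 := by
  have hN := h.N_expansion.self
  have hA := h.A_expansion.self
  have hB := h.B_expansion.self
  simp only [zpow_zero, one_mul] at hN hA hB
  have := (((hN.mul hA).mul (hB.mul hB)).mul (.of_angle continuous_sin)).isBigO_one.mul
    (isBigO_refl (fun p : ℝ × ℝ => p.1 ^ 2) infinity)
  exact this.congr (fun p => by rw [density]; ring) fun p => by ring

/-- With `E = radialCoeff`, the radial part is `sin θ [(2E + r E') r f' + E r² f'']`. Its flat terms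
give `-2k + k(k+1) = k(k-1)` for `a` and `-2(k+1) + (k+1)(k+2) = k(k+1)` for `b`. Next to leading
order, `2E + r E'` contributes `-2M` times `-k a` and `E` contributes `-2M` times `k(k+1) a`, in
total `-2 M k² a`. A source of relative order `r^{-2}` enters neither equation. -/
theorem IsAMC.coeff_equations (h : S.IsAMC M J) {f G : ℝ → ℝ → ℝ} {k : ℤ} {a b : ℝ → ℝ}
    (hs : SmoothAbove 2 S.rH f) (hf : HasFieldExpansion k f a b)
    (heq : ∀ r, S.rH < r → ∀ θ ∈ Ioo 0 π,
      radialDeriv (fun r θ => sin θ * (r ^ 2 * S.radialCoeff r θ * radialDeriv f r θ)) r θ +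
        angularDeriv (fun r θ => sin θ * (S.angularCoeff r θ * angularDeriv f r θ)) r θ = G r θ)
    (hG : (fun p : ℝ × ℝ => p.1 ^ k * G p.1 p.2) =O[infinity] fun p => p.1⁻¹ ^ 2)
    {θ : ℝ} (hθ : θ ∈ Ioo 0 π) :
    sin θ * deriv (deriv a) θ + cos θ * deriv a θ + k * (k - 1) * sin θ * a θ = 0 ∧
    sin θ * deriv (deriv b) θ + cos θ * deriv b θ + k * (k + 1) * sin θ * b θ
      - 2 * M * k ^ 2 * sin θ * a θ = 0 := by
  have hsin := HasExpansion.of_angle continuous_sin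
  have hcos := HasExpansion.of_angle continuous_cos
  have hE := h.radialCoeff_expansion
  have hE1 := h.radialDeriv_radialCoeff_expansion
  have hD := h.angularCoeff_expansion
  have hD1 := h.angularDeriv_angularCoeff_expansion
  have key := (hsin.mul (((((hE.const_mul 2).add hE1).mul hf.radial).add (hE.mul hf.radial₂)))).add
    ((hcos.mul (hD.mul hf.angular)).add
      (hsin.mul ((hD1.mul hf.angular).add (hD.mul hf.angular₂))))
  have hO := key.coeff_eq_zero ?_ hθ
  · constructor
    · linear_combination hO.1
    · linear_combination hO.2
  · refine hG.congr' ?_ EventuallyEq.rfl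
    filter_upwards [eventually_infinity_gt S.rH] with p hp
    rw [← heq _ hp.1 _ hp.2]
    have h1 : radialDeriv (fun r θ => sin θ * (r ^ 2 * S.radialCoeff r θ * radialDeriv f r θ))
        p.1 p.2 = _ :=
      (((((hasDerivAt_id p.1).pow 2).mul
        (S.smoothAbove_radialCoeff.hasDerivAt_radial two_ne_zero hp.1 (θ := p.2))).mul
        ((hs.radialDeriv one_add_one_eq_two.le).hasDerivAt_radial one_ne_zero hp.1
          (θ := p.2))).const_mul (sin p.2)).deriv
    have h2 : angularDeriv (fun r θ => sin θ * (S.angularCoeff r θ * angularDeriv f r θ))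
        p.1 p.2 = _ :=
      ((hasDerivAt_sin p.2).mul
        ((S.smoothAbove_angularCoeff.hasDerivAt_angular two_ne_zero hp.1 (θ := p.2)).mul
        ((hs.angularDeriv one_add_one_eq_two.le).hasDerivAt_angular one_ne_zero hp.1
          (θ := p.2)))).deriv
    rw [h1, h2]
    simp
    ring

end HartleThorne

/-! ### Regular solutions on the sphere -/

theorem eq_zero_on_Icc {g : ℝ → ℝ} (hg : Continuous g) (h : ∀ θ ∈ Ioo 0 π, g θ = 0) :
    ∀ θ ∈ Icc 0 π, g θ = 0 := by
  have : Icc 0 π ⊆ {θ | g θ = 0} := by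
    rw [← closure_Ioo pi_pos.ne]
    exact closure_minimal h (isClosed_eq hg continuous_const)
  exact this

theorem eq_on_Icc_of_deriv_eq_zero {g g' : ℝ → ℝ} (hd : ∀ θ, HasDerivAt g (g' θ) θ)
    (h : ∀ θ ∈ Icc 0 π, g' θ = 0) : ∀ θ ∈ Icc 0 π, g θ = g 0 :=
  constant_of_has_deriv_right_zero (fun θ _ => (hd θ).continuousAt.continuousWithinAt)
    fun θ hθ => by
      have := hd θ
      rw [h θ (Ico_subset_Icc_self hθ)] at this
      exact this.hasDerivWithinAt

/-- If `(sin θ w)' = 0` on the sphere and `w` is continuous, then `w = 0`. -/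
theorem eq_zero_of_sin_mul_deriv {w w' : ℝ → ℝ} (hd : ∀ θ, HasDerivAt w (w' θ) θ)
    (hw' : Continuous w') (h : ∀ θ ∈ Ioo 0 π, sin θ * w' θ + cos θ * w θ = 0) :
    ∀ θ ∈ Icc 0 π, w θ = 0 := by
  have hw : Continuous w := continuous_iff_continuousAt.2 fun θ => (hd θ).continuousAt
  have h1 := eq_on_Icc_of_deriv_eq_zero (fun θ => (hasDerivAt_sin θ).mul (hd θ))
    (eq_zero_on_Icc (by fun_prop) fun θ hθ => by linear_combination h θ hθ)
  refine eq_zero_on_Icc hw fun θ hθ => ?_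
  -- The constant value of `sin θ w` is its value at the pole `θ = 0`, which is zero.
  have h2 := h1 θ (Ioo_subset_Icc_self hθ)
  simpa [(sin_pos_of_mem_Ioo hθ).ne'] using h2

section

variable {u : ℝ → ℝ}

theorem hasDerivAt_of_contDiff_two (hu : ContDiff ℝ 2 u) (θ : ℝ) :
    HasDerivAt u (deriv u θ) θ ∧ HasDerivAt (deriv u) (deriv (deriv u) θ) θ :=
  ⟨(hu.differentiable two_ne_zero θ).hasDerivAt,
    ((ContDiff.deriv' (n := 1) hu).differentiable one_ne_zero θ).hasDerivAt⟩

theorem continuous_deriv_deriv (hu : ContDiff ℝ 2 u) : Continuous (deriv (deriv u)) :=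
  (ContDiff.deriv' (n := 1) hu).continuous_deriv_one

/-- The equation says `(sin θ w)' = 0` for `w = u' - m sin θ`, so `u' = m sin θ`. The case `m = 0`
serves for `μ₁`, the case `m = M` for the subleading coefficient of `φ₀`. -/
theorem harmonic_eq_const (hu : ContDiff ℝ 2 u) {m : ℝ}
    (h : ∀ θ ∈ Ioo 0 π, sin θ * deriv (deriv u) θ + cos θ * deriv u θ = 2 * m * sin θ * cos θ) :
    ∀ θ ∈ Icc 0 π, u θ + m * cos θ = u 0 + m := by
  have hd := hasDerivAt_of_contDiff_two hu
  have h1 := eq_zero_of_sin_mul_deriv (fun θ => (hd θ).2.sub ((hasDerivAt_sin θ).const_mul m))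
    ((continuous_deriv_deriv hu).sub (continuous_cos.const_mul m))
    fun θ hθ => by simp only [Pi.sub_apply]; linear_combination h θ hθ
  have h2 := eq_on_Icc_of_deriv_eq_zero (fun θ => (hd θ).1.add ((hasDerivAt_cos θ).const_mul m))
    fun θ hθ => by have := h1 θ hθ; simp only [Pi.sub_apply] at this; linear_combination this
  intro θ hθ
  simpa using h2 θ hθ

/-- The `ℓ = 1` harmonics that are regular on the sphere are the multiples of `cos θ`. -/
theorem legendre_one_eq_cos (hu : ContDiff ℝ 2 u)
    (h : ∀ θ ∈ Ioo 0 π, sin θ * deriv (deriv u) θ + cos θ * deriv u θ + 2 * sin θ * u θ = 0) :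
    ∀ θ ∈ Icc 0 π, u θ = u 0 * cos θ := by
  have hd := hasDerivAt_of_contDiff_two hu
  have hc := continuous_deriv_deriv hu
  have h0 := hu.continuous
  have hc1 : Continuous (deriv u) := (ContDiff.deriv' (n := 1) hu).continuous
  -- Here `w = cos θ u' + sin θ u` is the Wronskian of `u` with the known solution `cos θ`; by
  -- Abel's identity `sin θ w` is constant. Concluding from `w = 0` that `u / cos θ` is constant
  -- would fail across the equator.
  have h1 := eq_zero_of_sin_mul_deriv
    (fun θ => ((hasDerivAt_cos θ).mul (hd θ).2).add ((hasDerivAt_sin θ).mul (hd θ).1))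
    (by fun_prop) fun θ hθ => by
      simp only [Pi.add_apply, Pi.mul_apply]
      linear_combination cos θ * h θ hθ
  -- Subtracting `w = 0` from the equation leaves `sin θ (u'' + u) = 0`, the derivative of `sin θ u'
  -- - cos θ u`. This constant and `w = 0` form a linear system for `u` and `u'` of determinant one
  -- in modulus, so `u` follows without division.
  have h2 := eq_on_Icc_of_deriv_eq_zero
    (fun θ => ((hasDerivAt_sin θ).mul (hd θ).2).sub ((hasDerivAt_cos θ).mul (hd θ).1))
    (eq_zero_on_Icc (by fun_prop) fun θ hθ => by
      have := h1 θ (Ioo_subset_Icc_self hθ)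
      simp only [Pi.add_apply, Pi.mul_apply] at this
      linear_combination h θ hθ - this)
  intro θ hθ
  have e1 := h1 θ hθ
  have e2 := h2 θ hθ
  simp only [Pi.add_apply, Pi.mul_apply, Pi.sub_apply, sin_zero, cos_zero, zero_mul, one_mul,
    zero_sub] at e1 e2
  linear_combination sin θ * e1 - cos θ * e2 - u θ * sin_sq_add_cos_sq θ

end

theorem integral_cos_mul_sin : ∫ θ in (0 : ℝ)..π, cos θ * sin θ = 0 := by
  rw [intervalIntegral.integral_eq_sub_of_hasDerivAt (f := fun θ => sin θ ^ 2 / 2)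
    (fun θ _ => (((hasDerivAt_sin θ).pow 2).div_const 2).congr_deriv (by simp; ring))
    ((by fun_prop : Continuous fun θ => cos θ * sin θ).intervalIntegrable _ _)]
  simp

theorem integral_cos_sq_mul_sin : ∫ θ in (0 : ℝ)..π, cos θ * cos θ * sin θ = 2 / 3 := by
  rw [intervalIntegral.integral_eq_sub_of_hasDerivAt (f := fun θ => -(cos θ ^ 3) / 3)
    (fun θ _ => (((hasDerivAt_cos θ).pow 3).neg.div_const 3).congr_deriv (by simp; ring))
    ((by fun_prop : Continuous fun θ => cos θ * cos θ * sin θ).intervalIntegrable _ _)]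
  norm_num

theorem dipoleMode_const_add_cos {μ : ℝ → ℝ} {m c : ℝ}
    (h : ∀ θ ∈ Icc 0 π, μ θ = m + c * cos θ) : dipoleMode μ = c := by
  have h1 : ∫ θ in (0 : ℝ)..π, μ θ * cos θ * sin θ =
      ∫ θ in (0 : ℝ)..π, (m * (cos θ * sin θ) + c * (cos θ * cos θ * sin θ)) := by
    refine intervalIntegral.integral_congr fun θ hθ => ?_
    rw [uIcc_of_le pi_pos.le] at hθ
    simp only [h θ hθ]
    ring
  rw [dipoleMode, h1, intervalIntegral.integral_add
    ((by fun_prop : Continuous fun θ => m * (cos θ * sin θ)).intervalIntegrable _ _)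
    ((by fun_prop : Continuous fun θ => c * (cos θ * cos θ * sin θ)).intervalIntegrable _ _),
    intervalIntegral.integral_const_mul, intervalIntegral.integral_const_mul,
    integral_cos_mul_sin, integral_cos_sq_mul_sin]
  ring

/-! ### Regularity and symmetry of the coefficients -/

/-- An even `2π`-periodic function depends on `θ` through `cos θ` only; this carries identities from
`[0, π]` to all real angles. -/
theorem eq_arccos_cos {g : ℝ → ℝ} (h : ∀ θ, g (-θ) = g θ ∧ g (θ + 2 * π) = g θ) (θ : ℝ) :
    g θ = g (arccos (cos θ)) := by
  have hp : Function.Periodic g (2 * π) := fun θ => (h θ).2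
  obtain ⟨k, hk⟩ := Real.cos_eq_cos_iff.1 (cos_arccos (neg_one_le_cos θ) (cos_le_one θ))
  generalize arccos (cos θ) = φ at hk ⊢
  rcases hk with hk | hk
  · rw [show θ = φ + k * (2 * π) by linarith]
    exact hp.int_mul k φ
  · rw [show θ = -φ + k * (2 * π) by linarith]
    exact (hp.int_mul k _).trans (h _).1

theorem SmoothAbove.slice {n : WithTop ℕ∞} {R : ℝ} {f : ℝ → ℝ → ℝ} (h : SmoothAbove n R f) {r : ℝ}
    (hr : R < r) : ContDiff ℝ n (f r) :=
  ContDiffOn.comp_contDiff (g := Function.uncurry f) (f := fun θ => (r, θ)) h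
    (contDiff_const.prodMk contDiff_id) fun θ => ⟨hr, mem_univ θ⟩

/-- Since `r^{k+1} (f - ρ) = r a + b`, the values at the two radii `s` and `2s` determine `a` and
`b` linearly, and the coefficients inherit the regularity of `f` and `ρ`. -/
theorem contDiff_coeff {R : ℝ} {k : ℤ} {f ρ : ℝ → ℝ → ℝ} {a b : ℝ → ℝ} (hf : SmoothAbove 2 R f)
    (hρ : SmoothAbove 2 R ρ)
    (h : ∀ r, R < r → ∀ θ, f r θ = r ^ (-k) * a θ + r ^ (-k - 1) * b θ + ρ r θ) :
    ContDiff ℝ 2 a ∧ ContDiff ℝ 2 b := by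
  obtain ⟨s, hs, hs0⟩ : ∃ s, R < s ∧ 0 < s := ⟨max R 0 + 1, by
    have := le_max_left R 0; linarith, by have := le_max_right R 0; linarith⟩
  have hs2 : R < 2 * s := by linarith
  have e : ∀ r, R < r → 0 < r → ∀ θ, r ^ (k + 1) * (f r θ - ρ r θ) = r * a θ + b θ := by
    intro r hr hr0 θ
    have h1 : r ^ (k + 1) * r ^ (-k) = r := by rw [← zpow_add₀ hr0.ne']; simp
    have h2 : r ^ (k + 1) * r ^ (-k - 1) = 1 := by
      rw [← zpow_add₀ hr0.ne', show k + 1 + (-k - 1) = 0 by ring, zpow_zero]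
    rw [h r hr θ]
    linear_combination a θ * h1 + b θ * h2
  have c : ∀ r, R < r → ContDiff ℝ 2 fun θ => r ^ (k + 1) * (f r θ - ρ r θ) := fun r hr =>
    contDiff_const.mul ((hf.slice hr).sub (hρ.slice hr))
  have ha : a = fun θ => s⁻¹ * ((2 * s) ^ (k + 1) * (f (2 * s) θ - ρ (2 * s) θ) -
      s ^ (k + 1) * (f s θ - ρ s θ)) := by
    funext θ
    rw [e s hs hs0, e (2 * s) hs2 (by positivity)]
    field_simp
    ring
  have hb : b = fun θ => 2 * (s ^ (k + 1) * (f s θ - ρ s θ)) -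
      (2 * s) ^ (k + 1) * (f (2 * s) θ - ρ (2 * s) θ) := by
    funext θ
    rw [e s hs hs0, e (2 * s) hs2 (by positivity)]
    ring
  rw [ha, hb]
  exact ⟨contDiff_const.mul ((c _ hs2).sub (c _ hs)), (contDiff_const.mul (c _ hs)).sub (c _ hs2)⟩

/-- Uniqueness of expansions at fixed angles; it transfers the axial symmetry of `f` to its
coefficients. -/
theorem coeff_eq_of_eq {k : ℤ} {p : ℕ} (hp : (p : ℤ) = k + 2) {R : ℝ} {f ρ : ℝ → ℝ → ℝ}
    {a b : ℝ → ℝ} (hρ : ∀ θ, (fun r => ρ r θ) =O[atTop] fun r => r⁻¹ ^ p)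
    (h : ∀ r, R < r → ∀ θ, f r θ = r ^ (-k) * a θ + r ^ (-k - 1) * b θ + ρ r θ) {θ θ' : ℝ}
    (hθ : ∀ r, R < r → f r θ = f r θ') : a θ = a θ' ∧ b θ = b θ' := by
  suffices a θ - a θ' = 0 ∧ b θ - b θ' = 0 from
    ⟨sub_eq_zero.1 this.1, sub_eq_zero.1 this.2⟩
  refine eq_zero_of_isBigO_inv_sq (((isBigO_refl (fun r : ℝ => r ^ k) atTop).mul
    ((hρ θ').sub (hρ θ))).congr' ?_ ?_)
  · filter_upwards [eventually_gt_atTop R, eventually_gt_atTop 0] with r hr h0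
    have h1 := h r hr θ
    have h2 := h r hr θ'
    have h3 := hθ r hr
    have e1 : r ^ k * r ^ (-k) = 1 := by rw [← zpow_add₀ h0.ne']; simp
    rw [zpow_sub_one₀ h0.ne'] at h1 h2
    linear_combination r ^ k * (h1 - h2 - h3) +
      (a θ - a θ' + (b θ - b θ') * r⁻¹) * e1
  · filter_upwards [eventually_gt_atTop 0] with r h0
    rw [← zpow_natCast r⁻¹ p, hp, inv_zpow', neg_add, zpow_add₀ h0.ne', zpow_neg]
    have := zpow_ne_zero k h0.ne'
    field_simp

theorem coeff_eq_arccos_cos {k : ℤ} {p : ℕ} (hp : (p : ℤ) = k + 2) {R : ℝ} {f ρ : ℝ → ℝ → ℝ}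
    {a b : ℝ → ℝ} (hρ : ∀ θ, (fun r => ρ r θ) =O[atTop] fun r => r⁻¹ ^ p)
    (h : ∀ r, R < r → ∀ θ, f r θ = r ^ (-k) * a θ + r ^ (-k - 1) * b θ + ρ r θ)
    (hf : IsAxisSymmetric (Ioi R) f) (θ : ℝ) :
    a θ = a (arccos (cos θ)) ∧ b θ = b (arccos (cos θ)) :=
  coeff_eq_of_eq hp hρ h fun r hr => eq_arccos_cos (hf r hr) θ

end ScalarHair

namespace ScalarHair

open Asymptotics

theorem IsRegularOn.smoothAbove {a : ℝ} {f : ℝ → ℝ → ℝ} (h : IsRegularOn (Ici a) f) :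
    SmoothAbove 2 a f := h.1.mono (prod_mono Ioi_subset_Ici_self subset_rfl)

namespace HartleThorne

variable {S : HartleThorne} {M J : ℝ}

/-! ### Asymptotics of the homogeneous solution and of the scalar field -/

theorem wave_equation {f : ℝ → ℝ → ℝ} (hf : SmoothAbove 2 S.rH f) {F : ℝ → ℝ → ℝ} {ε : ℝ}
    (h : ∀ x ∈ S.exterior, dAlembertian S.metric (lift f) x + ε * lift F x = 0)
    (r : ℝ) (hr : S.rH < r) (θ : ℝ) (hθ : θ ∈ Ioo 0 π) :
    radialDeriv (fun r θ => sin θ * (r ^ 2 * S.radialCoeff r θ * radialDeriv f r θ)) r θ +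
      angularDeriv (fun r θ => sin θ * (S.angularCoeff r θ * angularDeriv f r θ)) r θ =
        -(ε * (F r θ * S.density r θ)) := by
  have hx : ![0, r, θ, 0] ∈ S.exterior := ⟨hr, hθ⟩
  have h1 := S.density_mul_dAlembertian hf hx
  have h2 := h _ hx
  simp only [lift, Matrix.cons_val] at h1 h2
  rw [← h1]
  linear_combination S.density r θ * h2

/-- Only the products `cos θ c₀` and `cos θ c₁` are determined, since `φ₀` does not see `c₀` and
`c₁` on the equator. They are the coefficients of an expansion with `k = -1`, and the remainder `ρ`
can be kept unchanged. -/
theorem homogeneous_asymptotics (h : S.IsAMC M J) {φ₀ : ℝ → ℝ → ℝ}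
    (hφ₀ : IsRegularOn (Ici S.rH) φ₀)
    (heq : ∀ x ∈ S.exterior, dAlembertian S.metric (lift φ₀) x = 0)
    (hlim : ∀ θ ∈ Icc 0 π, cos θ ≠ 0 →
      Tendsto (fun r => φ₀ r θ / (r * cos θ)) atTop (𝓝 1))
    (hexp : ∃ (c₀ c₁ : ℝ → ℝ) (ρ : ℝ → ℝ → ℝ), Continuous c₀ ∧ Continuous c₁ ∧
      IsRemainder 2 ρ ∧
      ∀ᶠ r in atTop, ∀ θ, φ₀ r θ = r * cos θ * (c₀ θ + c₁ θ / r + ρ r θ)) :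
    ∃ (R : ℝ) (ρ : ℝ → ℝ → ℝ), IsRemainder 2 ρ ∧
      ∀ r, R < r → ∀ θ, φ₀ r θ = r * cos θ * (1 - M / r + ρ r θ) := by
  obtain ⟨c₀, c₁, ρ, -, -, hρ, he⟩ := hexp
  obtain ⟨R₀, hR₀⟩ := eventually_atTop.1 he
  obtain ⟨R₁, hs⟩ := hρ.decaysLike.smooth
  obtain ⟨R, hR⟩ : ∃ R, R₀ ≤ R ∧ R₁ ≤ R ∧ S.rH ≤ R := ⟨max R₀ (max R₁ S.rH), by simp⟩
  have hφs := hφ₀.smoothAbove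
  have hpos : ∀ r, R < r → r ≠ 0 := fun r hr => (S.rH_pos.trans (hR.2.2.trans_lt hr)).ne'
  have hf : ∀ r, R < r → ∀ θ, φ₀ r θ = r ^ (-(-1) : ℤ) * (cos θ * c₀ θ) +
      r ^ (-(-1) - 1 : ℤ) * (cos θ * c₁ θ) + r * cos θ * ρ r θ := fun r hr θ => by
    have := hpos r hr
    rw [hR₀ r (hR.1.trans hr.le)]
    norm_num
    field_simp
  have hρ' : DecaysLike 1 fun r θ => r * cos θ * ρ r θ := hρ.decaysLike.mul_radius_cos
  obtain ⟨ha, hb⟩ := contDiff_coeff (hφs.mono hR.2.2)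
    ((smoothAbove_radius.mul smoothAbove_cos).mul (hs.mono hR.2.1)) hf
  have hfe := hρ'.hasFieldExpansion (k := -1) (by norm_num) ha hb hf
  have hρO : ∀ θ, (fun r => r * cos θ * ρ r θ) =O[atTop] fun r => r⁻¹ ^ 1 := fun θ => by
    refine (((isBigO_refl (fun r : ℝ => r) atTop).mul (hρ.isBigO_atTop θ)).const_mul_left
      (cos θ)).congr' (Eventually.of_forall fun r => by ring) ?_
    filter_upwards [eventually_gt_atTop 0] with r hr
    field_simp
  have hsymm := coeff_eq_arccos_cos (k := -1) (p := 1) (by norm_num) hρO hf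
    fun r hr => hφ₀.2 r (hR.2.2.trans hr.le)
  have hc₀ : ∀ θ ∈ Icc 0 π, cos θ * c₀ θ = cos θ := by
    intro θ hθ
    by_cases hc : cos θ = 0
    · simp [hc]
    have hx : Tendsto (fun r : ℝ => r⁻¹) atTop (𝓝 0) := tendsto_inv_atTop_zero
    have h1 : Tendsto (fun r => c₀ θ + c₁ θ * r⁻¹ + ρ r θ) atTop (𝓝 (c₀ θ)) := by
      simpa using ((hx.const_mul (c₁ θ)).const_add (c₀ θ)).add
        ((hρ.isBigO_atTop θ).trans_tendsto (by simpa using hx.pow 2))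
    have h2 : c₀ θ = 1 := by
      refine tendsto_nhds_unique (h1.congr' ?_) (hlim θ hθ hc)
      filter_upwards [eventually_gt_atTop R] with r hr
      have := hpos r hr
      rw [hR₀ r (hR.1.trans hr.le)]
      field_simp
    rw [h2, mul_one]
  have hacos : ∀ θ, cos θ * c₀ θ = cos θ := fun θ => by
    refine (hsymm θ).1.trans ?_
    rw [hc₀ _ ⟨arccos_nonneg _, arccos_le_pi _⟩, cos_arccos (neg_one_le_cos θ) (cos_le_one θ)]
  have hb1 := harmonic_eq_const hb (m := M) fun θ hθ => by
    have := (h.coeff_equations hφs hfe (G := fun _ _ => 0)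
      (fun r hr θ hθ => (wave_equation hφs (F := fun _ _ => 0) (ε := 0)
        (fun x hx => by rw [heq x hx]; simp) r hr θ hθ).trans (by simp))
      (by simpa using isBigO_zero _ _) hθ).2
    rw [hacos θ] at this
    push_cast at this
    linear_combination this
  have hbcos : ∀ θ ∈ Icc 0 π, cos θ * c₁ θ = -M * cos θ := fun θ hθ => by
    -- The equation fixes `cos θ c₁` up to an additive constant, and the factor `cos θ` makes that
    -- constant zero at the equator.
    have h1 := hb1 (π / 2) ⟨by positivity, by linarith [pi_pos]⟩
    have h2 := hb1 θ hθ
    simp only [cos_pi_div_two, cos_zero] at h1 h2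
    linear_combination h2 - h1
  refine ⟨R, ρ, hρ, fun r hr θ => ?_⟩
  have h1 := (hsymm θ).2.trans (hbcos _ ⟨arccos_nonneg _, arccos_le_pi _⟩)
  rw [cos_arccos (neg_one_le_cos θ) (cos_le_one θ)] at h1
  have := hpos r hr
  have h2 := hacos θ
  rw [hR₀ r (hR.1.trans hr.le)]
  field_simp
  linear_combination r * h2 + h1

theorem homogeneous_expansion {φ₀ ρ : ℝ → ℝ → ℝ} {R : ℝ} (hρ : IsRemainder 2 ρ)
    (h : ∀ r, R < r → ∀ θ, φ₀ r θ = r * cos θ * (1 - M / r + ρ r θ)) :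
    HasFieldExpansion (-1) φ₀ cos fun θ => -M * cos θ :=
  hρ.decaysLike.mul_radius_cos.hasFieldExpansion (by norm_num) contDiff_cos
    (contDiff_const.mul contDiff_cos) (R := max R 0) fun r hr θ => by
    have := (le_max_right R 0).trans_lt hr
    rw [h r ((le_max_left R 0).trans_lt hr)]
    norm_num
    field_simp
    ring

theorem IsAMC.source_isBigO (h : S.IsAMC M J) {F : ℝ → ℝ → ℝ}
    (hF : ∃ R C : ℝ, ∀ r, R < r → ∀ θ ∈ Icc 0 π, |F r θ| ≤ C / r ^ 5) :
    (fun p : ℝ × ℝ => F p.1 p.2 * S.density p.1 p.2) =O[infinity] fun p => p.1⁻¹ ^ 3 := by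
  obtain ⟨R, C, hF⟩ := hF
  have h1 : (fun p : ℝ × ℝ => F p.1 p.2) =O[infinity] fun p => p.1⁻¹ ^ 5 :=
    isBigO_infinity fun r hr θ hθ => hF r hr θ (Ioo_subset_Icc_self hθ)
  refine (h1.mul h.density_isBigO).congr' EventuallyEq.rfl ?_
  filter_upwards [eventually_infinity_gt 0] with p hp
  have := hp.1.ne'
  field_simp

/-- The density grows like `r²`, so the decay `r^{-5}` makes the source `O(r^{-3})`, which is
`O(r^{-2})` after the weight `r^k = r`: both coefficient equations are homogeneous. -/
theorem scalar_hair (h : S.IsAMC M J) {F : ℝ → ℝ → ℝ} {ε : ℝ}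
    (hF : ∃ R C : ℝ, ∀ r, R < r → ∀ θ ∈ Icc 0 π, |F r θ| ≤ C / r ^ 5)
    {Φ : ℝ → ℝ → ℝ} (hΦ : IsRegularOn (Ici S.rH) Φ)
    (hΦeq : ∀ x ∈ S.exterior, dAlembertian S.metric (lift Φ) x + ε * lift F x = 0)
    {μ₁ μ₂ : ℝ → ℝ} (hΦexp : IsRemainder 3 (fun r θ => Φ r θ - (μ₁ θ / r + μ₂ θ / r ^ 2))) :
    ∃ m₁ : ℝ, (∀ θ, μ₁ θ = m₁ ∧ μ₂ θ = M * m₁ + dipoleMode μ₂ * cos θ) ∧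
      HasFieldExpansion 1 Φ (fun _ => m₁) fun θ => M * m₁ + dipoleMode μ₂ * cos θ := by
  obtain ⟨R₁, hs⟩ := hΦexp.decaysLike.smooth
  obtain ⟨R, hR⟩ : ∃ R, R₁ ≤ R ∧ S.rH ≤ R := ⟨max R₁ S.rH, by simp⟩
  have hf : ∀ r, R < r → ∀ θ, Φ r θ = r ^ (-1 : ℤ) * μ₁ θ + r ^ (-1 - 1 : ℤ) * μ₂ θ +
      (fun r θ => Φ r θ - (μ₁ θ / r + μ₂ θ / r ^ 2)) r θ := fun r hr θ => by
    have := (S.rH_pos.trans (hR.2.trans_lt hr)).ne'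
    norm_num [zpow_neg]
    field_simp
    ring
  have hΦs := hΦ.smoothAbove
  obtain ⟨ha, hb⟩ := contDiff_coeff (hΦs.mono hR.2) (hs.mono hR.1) hf
  have hfe := hΦexp.decaysLike.hasFieldExpansion (k := 1) (by norm_num) ha hb hf
  have hG : (fun p : ℝ × ℝ => p.1 ^ (1 : ℤ) * (fun r θ => -(ε * (F r θ * S.density r θ))) p.1 p.2)
      =O[infinity] fun p => p.1⁻¹ ^ 2 := by
    refine (((isBigO_refl (fun p : ℝ × ℝ => p.1) infinity).mul
      (h.source_isBigO hF)).const_mul_left (-ε)).congr' ?_ ?_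
    · exact Eventually.of_forall fun p => by simp only [zpow_one]; ring
    · filter_upwards [eventually_infinity_gt 0] with p hp
      have := hp.1.ne'
      field_simp
  have heqs := fun θ (hθ : θ ∈ Ioo 0 π) =>
    h.coeff_equations hΦs hfe (wave_equation hΦs hΦeq) hG hθ
  have hsymm := coeff_eq_arccos_cos (k := 1) (p := 3) (by norm_num)
    (fun θ => hΦexp.isBigO_atTop θ) hf fun r hr => hΦ.2 r (hR.2.trans hr.le)
  have hμ₁ : ∀ θ ∈ Icc 0 π, μ₁ θ = μ₁ 0 := fun θ hθ => by
    simpa using harmonic_eq_const ha (m := 0) (fun θ hθ => by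
      have := (heqs θ hθ).1
      push_cast at this
      linear_combination this) θ hθ
  -- The constant `M μ₁` is a particular solution of `L μ₂ + 2 μ₂ = 2 M μ₁`.
  have hu : ContDiff ℝ 2 fun θ => μ₂ θ - M * μ₁ 0 := hb.sub contDiff_const
  have hμ₂ := legendre_one_eq_cos hu fun θ hθ => by
    have := (heqs θ hθ).2
    rw [hμ₁ θ (Ioo_subset_Icc_self hθ)] at this
    simp only [deriv_sub_const_fun]
    push_cast at this
    linear_combination this
  have hdip : dipoleMode μ₂ = μ₂ 0 - M * μ₁ 0 := dipoleMode_const_add_cos (m := M * μ₁ 0)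
    fun θ hθ => by linear_combination hμ₂ θ hθ
  have hall : ∀ θ, μ₁ θ = μ₁ 0 ∧ μ₂ θ = M * μ₁ 0 + dipoleMode μ₂ * cos θ := fun θ => by
    have hmem : arccos (cos θ) ∈ Icc 0 π := ⟨arccos_nonneg _, arccos_le_pi _⟩
    have h2 := hμ₂ _ hmem
    rw [cos_arccos (neg_one_le_cos θ) (cos_le_one θ)] at h2
    exact ⟨(hsymm θ).1.trans (hμ₁ _ hmem), by rw [(hsymm θ).2, hdip]; linear_combination h2⟩
  refine ⟨μ₁ 0, hall, ?_⟩
  rw [funext fun θ => (hall θ).1, funext fun θ => (hall θ).2] at hfe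
  exact hfe

end HartleThorne
end ScalarHair

namespace ScalarHair

namespace HartleThorne

variable {S : HartleThorne} {Ω : ℝ}

/-! ### The metric functions near the horizon -/

/-- The derivatives of `α` and `β` stay anonymous: they cancel in the determinant and in the
pullback of `r dr`, which is all that is used. -/
theorem jacobian_ingoingMap {α β : ℝ → ℝ → ℝ} {p : Coord}
    (hα : DifferentiableAt ℝ (Function.uncurry α) (p 1, p 2))
    (hβ : DifferentiableAt ℝ (Function.uncurry β) (p 1, p 2)) :
    ∃ a₁ a₂ b₁ b₂ ψ : ℝ, ψ = p 3 + β (p 1) (p 2) ∧ jacobian (ingoingMap α β) p =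
      !![1, a₁, a₂, 0;
         0, sin (p 2) * cos ψ - p 1 * sin (p 2) * sin ψ * b₁,
           p 1 * cos (p 2) * cos ψ - p 1 * sin (p 2) * sin ψ * b₂, -(p 1 * sin (p 2) * sin ψ);
         0, sin (p 2) * sin ψ + p 1 * sin (p 2) * cos ψ * b₁,
           p 1 * cos (p 2) * sin ψ + p 1 * sin (p 2) * cos ψ * b₂, p 1 * sin (p 2) * cos ψ;
         0, cos (p 2), -(p 1 * sin (p 2)), 0] := by
  obtain ⟨ha0, -, -, ha3⟩ := partialDeriv_lift hα
  obtain ⟨hb0, -, -, hb3⟩ := partialDeriv_lift hβ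
  have dα := (hasFDerivAt_lift hα).differentiableAt.hasFDerivAt
  have dβ := (hasFDerivAt_lift hβ).differentiableAt.hasFDerivAt
  have d : ∀ i : Fin 4, HasFDerivAt (fun q : Coord => q i)
      (ContinuousLinearMap.proj (R := ℝ) (φ := fun _ : Fin 4 => ℝ) i) p := fun i =>
    (ContinuousLinearMap.proj (R := ℝ) (φ := fun _ : Fin 4 => ℝ) i).hasFDerivAt
  have e0 := ((d 0).add dα).fderiv
  have e1 := (((d 1).mul (d 2).sin).mul ((d 3).add dβ).cos).fderiv
  have e2 := (((d 1).mul (d 2).sin).mul ((d 3).add dβ).sin).fderiv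
  have e3 := ((d 1).mul (d 2).cos).fderiv
  refine ⟨partialDeriv 1 (lift α) p, partialDeriv 2 (lift α) p, partialDeriv 1 (lift β) p,
    partialDeriv 2 (lift β) p, _, rfl, ?_⟩
  have f0 : ∀ v, fderiv ℝ (fun q => ingoingMap α β q 0) p v = v 0 + fderiv ℝ (lift α) p v := by
    intro v; exact congrArg (· v) e0
  have f1 : ∀ v, fderiv ℝ (fun q => ingoingMap α β q 1) p v =
      (p 1 * sin (p 2)) * (-sin (p 3 + β (p 1) (p 2)) * (v 3 + fderiv ℝ (lift β) p v)) +
      cos (p 3 + β (p 1) (p 2)) * (p 1 * (cos (p 2) * v 2) + sin (p 2) * v 1) := by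
    intro v; exact congrArg (· v) e1
  have f2 : ∀ v, fderiv ℝ (fun q => ingoingMap α β q 2) p v =
      (p 1 * sin (p 2)) * (cos (p 3 + β (p 1) (p 2)) * (v 3 + fderiv ℝ (lift β) p v)) +
      sin (p 3 + β (p 1) (p 2)) * (p 1 * (cos (p 2) * v 2) + sin (p 2) * v 1) := by
    intro v; exact congrArg (· v) e2
  have f3 : ∀ v, fderiv ℝ (fun q => ingoingMap α β q 3) p v =
      p 1 * (-sin (p 2) * v 2) + cos (p 2) * v 1 := by
    intro v; exact congrArg (· v) e3
  simp only [partialDeriv] at ha0 ha3 hb0 hb3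
  ext i j
  fin_cases i <;> fin_cases j <;>
    simp [jacobian, partialDeriv, f0, f1, f2, f3, ha0, ha3, hb0, hb3] <;> ring

/-- The covector `r dr` in the coordinates `(v, x, y, z)`. -/
def conormal (x : EuclideanSpace ℝ (Fin 3)) : Coord := ![0, x 0, x 1, x 2]

/-- The norm of the covector `r dr`. -/
def conormalNorm (G : EuclideanSpace ℝ (Fin 3) → Matrix (Fin 4) (Fin 4) ℝ)
    (x : EuclideanSpace ℝ (Fin 3)) : ℝ :=
  conormal x ⬝ᵥ ((G x)⁻¹ *ᵥ conormal x)

theorem norm_sq_eq (x : EuclideanSpace ℝ (Fin 3)) :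
    ‖x‖ ^ 2 = x 0 ^ 2 + x 1 ^ 2 + x 2 ^ 2 := by
  simp [EuclideanSpace.norm_sq_eq, Fin.sum_univ_three]

/-- The covector `G X` annihilates the tangent space of the sphere, so it is `c n` with `n` the
conormal, and `c ≠ 0` because `X ≠ 0`. As `X = c G⁻¹ n` is itself tangent, `0 = n · X = c (n · G⁻¹
n)`. -/
theorem conormalNorm_eq_zero {G : EuclideanSpace ℝ (Fin 3) → Matrix (Fin 4) (Fin 4) ℝ}
    {x : EuclideanSpace ℝ (Fin 3)} (hx : x ≠ 0) (hsymm : (G x).IsSymm) (hdet : (G x).det < 0)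
    (h : ∀ w : Coord, x 0 * w 1 + x 1 * w 2 + x 2 * w 3 = 0 →
      generatorCartesian Ω x ⬝ᵥ (G x *ᵥ w) = 0) : conormalNorm G x = 0 := by
  set X := generatorCartesian Ω x with hX
  set n := conormal x with hn
  have hnorm : 0 < x 0 ^ 2 + x 1 ^ 2 + x 2 ^ 2 := by
    rw [← norm_sq_eq]; have := norm_pos_iff.2 hx; positivity
  have hnn : n ⬝ᵥ n = x 0 ^ 2 + x 1 ^ 2 + x 2 ^ 2 := by
    simp [hn, conormal, dotProduct, Fin.sum_univ_four]; ring
  have hnw : ∀ w : Coord, n ⬝ᵥ w = x 0 * w 1 + x 1 * w 2 + x 2 * w 3 := fun w => by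
    simp [hn, conormal, dotProduct, Fin.sum_univ_four]
  have hunit : IsUnit (G x).det := isUnit_iff_ne_zero.2 hdet.ne
  have hGX : ∀ w, X ⬝ᵥ (G x *ᵥ w) = (G x *ᵥ X) ⬝ᵥ w := fun w => by
    rw [Matrix.dotProduct_mulVec, ← Matrix.mulVec_transpose, hsymm.eq]
  obtain ⟨c, hc⟩ : ∃ c : ℝ, G x *ᵥ X = c • n := by
    refine ⟨((G x *ᵥ X) ⬝ᵥ n) / (n ⬝ᵥ n), dotProduct_eq _ _ fun w => ?_⟩
    have h1 := h (w - (n ⬝ᵥ w / n ⬝ᵥ n) • n) (by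
      rw [← hnw, dotProduct_sub, dotProduct_smul, smul_eq_mul, div_mul_cancel₀ _ (hnn ▸ hnorm.ne'),
        sub_self])
    rw [hGX, dotProduct_sub, dotProduct_smul, smul_eq_mul] at h1
    rw [smul_dotProduct, smul_eq_mul]
    linear_combination h1
  have hXn : n ⬝ᵥ X = 0 := by
    rw [hnw]; simp [hX, generatorCartesian]; ring
  have hinv : X = c • ((G x)⁻¹ *ᵥ n) := by
    rw [← Matrix.mulVec_smul, ← hc, Matrix.mulVec_mulVec, Matrix.nonsing_inv_mul _ hunit,
      Matrix.one_mulVec]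
  have hc0 : c ≠ 0 := by
    rintro rfl
    have := congrFun hinv 0
    simp [hX, generatorCartesian] at this
  have h2 : n ⬝ᵥ X = c * conormalNorm G x := by
    conv_lhs => rw [hinv]
    rw [dotProduct_smul, smul_eq_mul]; rfl
  rw [hXn] at h2
  exact (mul_eq_zero.1 h2.symm).resolve_left hc0

theorem continuousOn_conormalNorm {G : EuclideanSpace ℝ (Fin 3) → Matrix (Fin 4) (Fin 4) ℝ}
    {s : Set (EuclideanSpace ℝ (Fin 3))} (hG : ContinuousOn G s) (hdet : ∀ x ∈ s, (G x).det < 0) :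
    ContinuousOn (conormalNorm G) s := by
  have hn : Continuous conormal := continuous_pi fun i => by
    fin_cases i <;> simp [conormal] <;> fun_prop
  have hi : ContinuousOn (fun x => (G x)⁻¹) s := by
    simp only [Matrix.inv_def, Ring.inverse_eq_inv']
    exact (((Continuous.matrix_det continuous_id).comp_continuousOn hG).inv₀ fun x hx =>
      (hdet x hx).ne).smul ((Continuous.matrix_adjugate continuous_id).comp_continuousOn hG)
  rw [continuousOn_iff_continuous_domRestrict] at hi ⊢
  have hn' : Continuous fun x : s => conormal x := hn.comp continuous_subtype_val
  exact hn'.dotProduct (hi.matrix_mulVec hn')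

/-- The Jacobian has the determinant `r² sin θ` of flat spherical coordinates, so comparing
determinants leaves `N A B²`. The last identity is `g^{rr} = 1 / A²`, read in the coordinates where
`G` extends to the horizon. -/
theorem ingoing_identities {α β : ℝ → ℝ → ℝ} {p : Coord} (hp : p ∈ S.exterior)
    (hα : DifferentiableAt ℝ (Function.uncurry α) (p 1, p 2))
    (hβ : DifferentiableAt ℝ (Function.uncurry β) (p 1, p 2))
    {G : EuclideanSpace ℝ (Fin 3) → Matrix (Fin 4) (Fin 4) ℝ} {x : EuclideanSpace ℝ (Fin 3)}
    (hx : x = !₂[ingoingMap α β p 1, ingoingMap α β p 2, ingoingMap α β p 3])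
    (hdet : (G x).det < 0)
    (h : S.metric p = (jacobian (ingoingMap α β) p)ᵀ * G x * jacobian (ingoingMap α β) p) :
    ‖x‖ = p 1 ∧ (S.N (p 1) (p 2) * S.A (p 1) (p 2) * S.B (p 1) (p 2) ^ 2) ^ 2 = -(G x).det ∧
      S.A (p 1) (p 2) ^ 2 * conormalNorm G x = p 1 ^ 2 := by
  obtain ⟨a₁, a₂, b₁, b₂, ψ, hψ, hJ⟩ := jacobian_ingoingMap hα hβ
  set r := p 1 with hr
  set θ := p 2 with hθ
  have hr0 : 0 < r := S.rH_pos.trans hp.1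
  have hs : 0 < sin θ := sin_pos_of_mem_Ioo hp.2
  have hA := S.A_pos r hp.1 θ
  have x0 : x 0 = r * sin θ * cos ψ := by rw [hx, hψ]; rfl
  have x1 : x 1 = r * sin θ * sin ψ := by rw [hx, hψ]; rfl
  have x2 : x 2 = r * cos θ := by rw [hx]; rfl
  set A := jacobian (ingoingMap α β) p
  have hdetJ : A.det = r ^ 2 * sin θ := by
    rw [hJ]
    simp [Matrix.det_succ_row_zero, Fin.sum_univ_succ, Fin.succAbove]
    linear_combination (r ^ 2 * sin θ * (sin θ ^ 2 + cos θ ^ 2)) * sin_sq_add_cos_sq ψ +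
      r ^ 2 * sin θ * sin_sq_add_cos_sq θ
  have hn : Aᵀ *ᵥ conormal x = ![0, r, 0, 0] := by
    rw [hJ]
    ext i
    fin_cases i <;>
      simp [Matrix.mulVec, dotProduct, Fin.sum_univ_four, conormal, x0, x1, x2]
    · linear_combination (r * sin θ ^ 2) * sin_sq_add_cos_sq ψ + r * sin_sq_add_cos_sq θ
    · linear_combination (r ^ 2 * sin θ * cos θ) * sin_sq_add_cos_sq ψ
    · ring
  refine ⟨?_, ?_, ?_⟩
  · rw [← sq_eq_sq₀ (norm_nonneg _) hr0.le, norm_sq_eq, x0, x1, x2]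
    linear_combination (r ^ 2 * sin θ ^ 2) * sin_sq_add_cos_sq ψ + r ^ 2 * sin_sq_add_cos_sq θ
  · have h1 := congrArg Matrix.det h
    rw [S.det_metric, Matrix.det_mul, Matrix.det_mul, Matrix.det_transpose, hdetJ, density,
      ← hr, ← hθ] at h1
    have h2 : (r ^ 2 * sin θ) ^ 2 ≠ 0 := by positivity
    refine mul_left_cancel₀ h2 ?_
    linear_combination -h1
  · have hu : IsUnit Aᵀ.det := by
      rw [Matrix.det_transpose, hdetJ, isUnit_iff_ne_zero]; positivity
    have hGu : IsUnit (G x).det := isUnit_iff_ne_zero.2 hdet.ne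
    have h1 : S.metric p *ᵥ ![0, r, 0, 0] = S.A r θ ^ 2 • ![0, r, 0, 0] := by
      ext i
      fin_cases i <;> simp [metric, Matrix.mulVec, dotProduct, Fin.sum_univ_four, ← hr, ← hθ]
    have h2 : Aᵀ *ᵥ (G x *ᵥ (A *ᵥ ![0, r, 0, 0])) = Aᵀ *ᵥ (S.A r θ ^ 2 • conormal x) := by
      rw [Matrix.mulVec_smul, hn, ← h1, h, Matrix.mulVec_mulVec, Matrix.mulVec_mulVec]
    have h3 : G x *ᵥ (A *ᵥ ![0, r, 0, 0]) = S.A r θ ^ 2 • conormal x :=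
      Matrix.mulVec_injective_of_isUnit ((Matrix.isUnit_iff_isUnit_det _).2 hu) h2
    have h4 : A *ᵥ ![0, r, 0, 0] = S.A r θ ^ 2 • ((G x)⁻¹ *ᵥ conormal x) := by
      rw [← Matrix.mulVec_smul, ← h3, Matrix.mulVec_mulVec, Matrix.nonsing_inv_mul _ hGu,
        Matrix.one_mulVec]
    have h5 : conormal x ⬝ᵥ (A *ᵥ ![0, r, 0, 0]) = r ^ 2 := by
      rw [Matrix.dotProduct_mulVec, ← Matrix.mulVec_transpose, hn]
      simp [dotProduct, Fin.sum_univ_four]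
      ring
    rw [← h5, h4, dotProduct_smul, smul_eq_mul]
    rfl

/-- The volume density stays bounded at the horizon, and the coefficient of the radial flux
tends to zero uniformly. -/
theorem HasHorizon.bounds (h : S.HasHorizon Ω) :
    (∃ C, ∀ r ∈ Ioo S.rH (S.rH + 1), ∀ θ ∈ Ioo 0 π,
      S.N r θ * S.A r θ * S.B r θ ^ 2 ≤ C) ∧
    ∀ ε > 0, ∃ δ > 0, ∀ r ∈ Ioo S.rH (S.rH + δ), ∀ θ ∈ Ioo 0 π,
      |r ^ 2 * S.radialCoeff r θ| ≤ ε := by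
  obtain ⟨α, β, G, hα, hβ, hG, hGs, hmet, hnull⟩ := h
  have hopen : IsOpen (Ioi S.rH ×ˢ Ioo 0 π) := isOpen_Ioi.prod isOpen_Ioo
  have key : ∀ r, S.rH < r → ∀ θ ∈ Ioo 0 π, ∃ x : EuclideanSpace ℝ (Fin 3), ‖x‖ = r ∧
      (S.N r θ * S.A r θ * S.B r θ ^ 2) ^ 2 = -(G x).det ∧
      S.A r θ ^ 2 * conormalNorm G x = r ^ 2 := by
    intro r hr θ hθ
    have hp : ![0, r, θ, 0] ∈ S.exterior := ⟨hr, hθ⟩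
    have hd : ∀ {γ : ℝ → ℝ → ℝ}, ContDiffOn ℝ 1 (Function.uncurry γ) (Ioi S.rH ×ˢ Ioo 0 π) →
        DifferentiableAt ℝ (Function.uncurry γ) (r, θ) := fun hγ =>
      (hγ.differentiableOn one_ne_zero).differentiableAt (hopen.mem_nhds ⟨hr, hθ⟩)
    have hx : ‖(!₂[ingoingMap α β ![0, r, θ, 0] 1, ingoingMap α β ![0, r, θ, 0] 2,
        ingoingMap α β ![0, r, θ, 0] 3] : EuclideanSpace ℝ (Fin 3))‖ = r := by
      rw [← sq_eq_sq₀ (norm_nonneg _) (S.rH_pos.trans hr).le, norm_sq_eq]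
      simp [ingoingMap]
      linear_combination (r ^ 2 * sin θ ^ 2) * sin_sq_add_cos_sq (β r θ) +
        r ^ 2 * sin_sq_add_cos_sq θ
    exact ⟨_, ingoing_identities hp (hd hα) (hd hβ) rfl (hGs _ (hr.le.trans_eq hx.symm)).2 (hmet _ hp)⟩
  -- In Cartesian coordinates a closed shell that includes the axis and the horizon is compact, so
  -- the bounds are uniform in the angle.
  set K : Set (EuclideanSpace ℝ (Fin 3)) := {x | S.rH ≤ ‖x‖ ∧ ‖x‖ ≤ S.rH + 1} with hK
  have hKc : IsCompact K := by
    refine (isCompact_closedBall (0 : EuclideanSpace ℝ (Fin 3)) (S.rH + 1)).of_isClosed_subset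
      ((isClosed_le continuous_const continuous_norm).inter
        (isClosed_le continuous_norm continuous_const)) fun x hx => ?_
    simpa using hx.2
  have hKs : K ⊆ {x | S.rH ≤ ‖x‖} := fun x hx => hx.1
  have hGK := hG.mono hKs
  obtain ⟨D, hD⟩ := hKc.exists_bound_of_continuousOn
    ((Continuous.matrix_det continuous_id).comp_continuousOn hGK)
  have hbound : ∀ r ∈ Ioo S.rH (S.rH + 1), ∀ θ ∈ Ioo 0 π,
      S.N r θ * S.A r θ * S.B r θ ^ 2 ≤ √D := by
    intro r hr θ hθ
    obtain ⟨x, hx, h1, -⟩ := key r hr.1 θ hθ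
    have h2 := hD x ⟨hx ▸ hr.1.le, hx ▸ hr.2.le⟩
    refine Real.le_sqrt_of_sq_le ?_
    rw [h1]
    exact (neg_le_abs _).trans h2
  refine ⟨⟨_, hbound⟩, fun ε hε => ?_⟩
  have hunif := hKc.uniformContinuousOn_of_continuous
    (continuousOn_conormalNorm hGK fun x hx => (hGs x hx.1).2)
  obtain ⟨δ, hδ, hu⟩ := Metric.uniformContinuousOn_iff.1 hunif (ε / (√D + 1)) (by positivity)
  refine ⟨min δ 1, by positivity, fun r hr θ hθ => ?_⟩
  have hr1 : r < S.rH + 1 := hr.2.trans_le (by simp)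
  have hrδ : r < S.rH + δ := hr.2.trans_le (by simp)
  have hH := S.rH_pos
  have hr0 : 0 < r := hH.trans hr.1
  obtain ⟨x, hx, -, h2⟩ := key r hr.1 θ hθ
  -- The radial projection of `x` to the horizon is at distance `r - rH`, and the norm of the
  -- conormal vanishes there; uniform continuity bounds it at `x`.
  have hy : ‖(S.rH / r) • x‖ = S.rH := by
    rw [norm_smul, hx, norm_of_nonneg (by positivity)]; field_simp
  have hdist : dist x ((S.rH / r) • x) < δ := by
    have : x - (S.rH / r) • x = (1 - S.rH / r) • x := by module
    rw [dist_eq_norm, this, norm_smul, hx, norm_of_nonneg (by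
      rw [sub_nonneg, div_le_one hr0]; exact hr.1.le), sub_mul, div_mul_cancel₀ _ hr0.ne']
    linarith
  have h3 := hu x ⟨hx ▸ hr.1.le, hx ▸ hr1.le⟩ _ ⟨hy.ge, hy.le.trans (by linarith)⟩ hdist
  have hy0 : (S.rH / r) • x ≠ 0 := norm_pos_iff.1 (hH.trans_eq hy.symm)
  rw [conormalNorm_eq_zero hy0 (hGs _ hy.ge).1 (hGs _ hy.ge).2 (hnull _ hy), dist_zero_right,
    norm_eq_abs] at h3
  have hN := S.N_pos r hr.1 θ
  have hA := S.A_pos r hr.1 θ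
  have hB := S.B_pos r hr.1 θ
  have h4 : r ^ 2 * S.radialCoeff r θ =
      S.N r θ * S.A r θ * S.B r θ ^ 2 * conormalNorm G x := by
    rw [radialCoeff, ← h2]; field_simp
  rw [h4, abs_mul, abs_of_pos (by positivity)]
  calc _ ≤ √D * (ε / (√D + 1)) := by
        gcongr
        exact hbound r ⟨hr.1, hr1⟩ θ hθ
    _ ≤ ε := by
        rw [← mul_div_assoc, div_le_iff₀ (by positivity)]
        nlinarith [Real.sqrt_nonneg D]

end HartleThorne
end ScalarHair

namespace ScalarHair

open Asymptotics

/-! ### Limits of the boundary terms in Green's identity -/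

/-- `W = r a + b + O(1/r)`: the growing term has zero integral over the angle, and the error tends
to zero uniformly. -/
theorem tendsto_integral_of_hasExpansion {W : ℝ → ℝ → ℝ} {a b : ℝ → ℝ} {R : ℝ}
    (hW : HasExpansion (fun r θ => r⁻¹ * W r θ) a b) (hc : ∀ r, R < r → Continuous (W r))
    (ha : ∫ θ in Ioo 0 π, a θ = 0) :
    Tendsto (fun r => ∫ θ in Ioo 0 π, W r θ) atTop (𝓝 (∫ θ in Ioo 0 π, b θ)) := by
  have hint : ∀ {g : ℝ → ℝ}, Continuous g → IntegrableOn g (Ioo 0 π) := fun hg =>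
    (hg.continuousOn.integrableOn_compact isCompact_Icc).mono_set Ioo_subset_Icc_self
  obtain ⟨C, hC⟩ := hW.3.bound
  have hC' := eventually_infinity (P := fun r θ => ‖r⁻¹ * W r θ - (a θ + b θ * r⁻¹)‖ ≤
    C * ‖r⁻¹ ^ 2‖).1 hC
  rw [tendsto_iff_norm_sub_tendsto_zero]
  have hx : Tendsto (fun r : ℝ => C * r⁻¹ * volume.real (Ioo 0 π)) atTop (𝓝 0) := by
    simpa using (tendsto_inv_atTop_zero.const_mul C).mul_const (volume.real (Ioo 0 π))
  refine squeeze_zero' (Eventually.of_forall fun r => norm_nonneg _) ?_ hx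
  filter_upwards [hC', eventually_gt_atTop R, eventually_gt_atTop 0] with r h1 hr h0
  have hWi := hint (hc r hr)
  have hai := (hint hW.1).const_mul r
  have hbi := hint hW.2
  have e : (∫ θ in Ioo 0 π, W r θ) - ∫ θ in Ioo 0 π, b θ =
      ∫ θ in Ioo 0 π, (W r θ - b θ - r * a θ) := by
    have e1 := integral_sub (hWi.sub hbi) hai
    simp only [Pi.sub_apply] at e1
    rw [e1, integral_sub hWi hbi, integral_const_mul, ha, mul_zero, sub_zero]
  rw [e]
  refine norm_setIntegral_le_of_norm_le_const measure_Ioo_lt_top fun θ hθ => ?_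
  have h2 := h1 θ hθ
  have h3 : W r θ - b θ - r * a θ = r * (r⁻¹ * W r θ - (a θ + b θ * r⁻¹)) := by
    field_simp
    ring
  rw [h3, norm_mul, norm_of_nonneg h0.le]
  refine (mul_le_mul_of_nonneg_left h2 h0.le).trans_eq ?_
  rw [norm_of_nonneg (by positivity)]
  field_simp

theorem IsRegularOn.exists_bound {a : ℝ} {f : ℝ → ℝ → ℝ} (h : IsRegularOn (Ici a) f) (b : ℝ) :
    ∃ C, 0 ≤ C ∧ ∀ r ∈ Ioo a b, ∀ θ ∈ Ioo 0 π, |f r θ| ≤ C ∧ |radialDeriv f r θ| ≤ C := by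
  have hc : IsCompact (Icc a b ×ˢ Icc 0 π) := isCompact_Icc.prod isCompact_Icc
  have hsub : Icc a b ×ˢ Icc 0 π ⊆ Ici a ×ˢ univ :=
    prod_mono Icc_subset_Ici_self (subset_univ _)
  obtain ⟨C₁, h1⟩ := hc.exists_bound_of_continuousOn (h.1.continuousOn.mono hsub)
  -- The derivative within the closed region is continuous up to `r = a`, hence bounded on a compact
  -- set, and it agrees with the ordinary derivative for `r > a`.
  have hd := (h.1.continuousOn_fderivWithin ((uniqueDiffOn_Ici a).prod uniqueDiffOn_univ)
    one_le_two).clm_apply (continuousOn_const (c := ((1 : ℝ), (0 : ℝ))))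
  obtain ⟨C₂, h2⟩ := hc.exists_bound_of_continuousOn (hd.mono hsub)
  refine ⟨max (max C₁ C₂) 0, le_max_right _ _, fun r hr θ hθ => ?_⟩
  have hmem : (r, θ) ∈ Icc a b ×ˢ Icc 0 π :=
    ⟨Ioo_subset_Icc_self hr, Ioo_subset_Icc_self hθ⟩
  refine ⟨(h1 _ hmem).trans (by simp), ?_⟩
  have h3 := h2 _ hmem
  rw [fderivWithin_of_mem_nhds (prod_mem_nhds (Ici_mem_nhds hr.1) univ_mem)] at h3
  rw [radialDeriv, (hasDerivAt_radial_fderiv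
    (h.smoothAbove.differentiableAt two_ne_zero hr.1)).deriv]
  exact h3.trans (by simp)

namespace HartleThorne

variable {S : HartleThorne} {M J Ω ε : ℝ}

variable (S) in
/-- The radial flux in Green's identity for two functions. -/
def radialFlux (f g : ℝ → ℝ → ℝ) (r θ : ℝ) : ℝ :=
  f r θ * (sin θ * (r ^ 2 * S.radialCoeff r θ * radialDeriv g r θ)) -
    g r θ * (sin θ * (r ^ 2 * S.radialCoeff r θ * radialDeriv f r θ))

variable (S) in
/-- The angular flux in Green's identity for two functions. -/
def angularFlux (f g : ℝ → ℝ → ℝ) (r θ : ℝ) : ℝ :=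
  f r θ * (sin θ * (S.angularCoeff r θ * angularDeriv g r θ)) -
    g r θ * (sin θ * (S.angularCoeff r θ * angularDeriv f r θ))

/-! ### Green's identity on a shell -/

section Green

variable {f g : ℝ → ℝ → ℝ}

theorem smoothAbove_radial (hf : SmoothAbove 2 S.rH f) : SmoothAbove 1 S.rH
    fun r θ => sin θ * (r ^ 2 * S.radialCoeff r θ * radialDeriv f r θ) :=
  smoothAbove_sin.mul (((smoothAbove_radius.pow 2).mul
    (S.smoothAbove_radialCoeff.of_le one_le_two)).mul (hf.radialDeriv one_add_one_eq_two.le))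

theorem smoothAbove_angular (hf : SmoothAbove 2 S.rH f) : SmoothAbove 1 S.rH
    fun r θ => sin θ * (S.angularCoeff r θ * angularDeriv f r θ) :=
  smoothAbove_sin.mul ((S.smoothAbove_angularCoeff.of_le one_le_two).mul
    (hf.angularDeriv one_add_one_eq_two.le))

theorem smoothAbove_radialFlux (hf : SmoothAbove 2 S.rH f) (hg : SmoothAbove 2 S.rH g) :
    SmoothAbove 1 S.rH (S.radialFlux f g) :=
  ((hf.of_le one_le_two).mul (smoothAbove_radial hg)).sub
    ((hg.of_le one_le_two).mul (smoothAbove_radial hf))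

theorem smoothAbove_angularFlux (hf : SmoothAbove 2 S.rH f) (hg : SmoothAbove 2 S.rH g) :
    SmoothAbove 1 S.rH (S.angularFlux f g) :=
  ((hf.of_le one_le_two).mul (smoothAbove_angular hg)).sub
    ((hg.of_le one_le_two).mul (smoothAbove_angular hf))

/-- The terms with one derivative on each of `f` and `g` are symmetric and cancel. -/
theorem divergence_flux (hf : SmoothAbove 2 S.rH f) (hg : SmoothAbove 2 S.rH g) {r θ : ℝ}
    (hr : S.rH < r) :
    radialDeriv (S.radialFlux f g) r θ + angularDeriv (S.angularFlux f g) r θ =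
      f r θ * (radialDeriv
        (fun r θ => sin θ * (r ^ 2 * S.radialCoeff r θ * radialDeriv g r θ)) r θ +
        angularDeriv (fun r θ => sin θ * (S.angularCoeff r θ * angularDeriv g r θ)) r θ) -
      g r θ * (radialDeriv
        (fun r θ => sin θ * (r ^ 2 * S.radialCoeff r θ * radialDeriv f r θ)) r θ +
        angularDeriv (fun r θ => sin θ * (S.angularCoeff r θ * angularDeriv f r θ)) r θ) := by
  have h2 : (2 : WithTop ℕ∞) ≠ 0 := two_ne_zero
  have h1 : (1 : WithTop ℕ∞) ≠ 0 := one_ne_zero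
  have e1 : radialDeriv (S.radialFlux f g) r θ = _ :=
    (((hf.hasDerivAt_radial h2 hr (θ := θ)).mul
      ((smoothAbove_radial hg).hasDerivAt_radial h1 hr (θ := θ))).sub
    ((hg.hasDerivAt_radial h2 hr (θ := θ)).mul
      ((smoothAbove_radial hf).hasDerivAt_radial h1 hr (θ := θ)))).deriv
  have e2 : angularDeriv (S.angularFlux f g) r θ = _ :=
    (((hf.hasDerivAt_angular h2 hr (θ := θ)).mul
      ((smoothAbove_angular hg).hasDerivAt_angular h1 hr (θ := θ))).sub
    ((hg.hasDerivAt_angular h2 hr (θ := θ)).mul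
      ((smoothAbove_angular hf).hasDerivAt_angular h1 hr (θ := θ)))).deriv
  rw [e1, e2]
  ring

/-- The divergence theorem on a rectangle in `(r, θ)`; the sides `θ = 0` and `θ = π` contribute
nothing because `angularFlux` has the factor `sin θ`. -/
theorem green_identity (hf : SmoothAbove 2 S.rH f) (hg : SmoothAbove 2 S.rH g) {q : ℝ → ℝ → ℝ}
    {r₁ r₂ : ℝ} (h₁ : S.rH < r₁) (h₁₂ : r₁ ≤ r₂)
    (h : ∀ r ∈ Ioo r₁ r₂, ∀ θ ∈ Ioo 0 π,
      radialDeriv (S.radialFlux f g) r θ + angularDeriv (S.angularFlux f g) r θ = q r θ) :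
    ∫ p in Ioo r₁ r₂ ×ˢ Ioo 0 π, q p.1 p.2 =
      (∫ θ in Ioo 0 π, S.radialFlux f g r₂ θ) - ∫ θ in Ioo 0 π, S.radialFlux f g r₁ θ := by
  have hu := smoothAbove_radialFlux hf hg
  have hv := smoothAbove_angularFlux hf hg
  have hsub : Icc (r₁, (0 : ℝ)) (r₂, π) ⊆ Ioi S.rH ×ˢ univ := fun p hp =>
    ⟨h₁.trans_le hp.1.1, mem_univ _⟩
  have hsub' : ∀ p ∈ Ioo r₁ r₂ ×ˢ Ioo 0 π, S.rH < p.1 := fun p hp => h₁.trans hp.1.1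
  have hcont : ∀ {w : ℝ → ℝ → ℝ}, SmoothAbove 1 S.rH w → ∀ c : ℝ × ℝ,
      ContinuousOn (fun p => fderiv ℝ (Function.uncurry w) p c) (Icc (r₁, (0 : ℝ)) (r₂, π)) :=
    fun hw c => ((hw.continuousOn_fderiv_of_isOpen isOpen_above le_rfl).clm_apply
      continuousOn_const).mono hsub
  have key := integral_divergence_prod_Icc_of_hasFDerivAt_of_le
    (Function.uncurry (S.radialFlux f g)) (Function.uncurry (S.angularFlux f g))
    (fderiv ℝ (Function.uncurry (S.radialFlux f g)))
    (fderiv ℝ (Function.uncurry (S.angularFlux f g))) (r₁, 0) (r₂, π)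
    (Prod.mk_le_mk.2 ⟨h₁₂, pi_pos.le⟩)
    (hu.continuousOn.mono hsub) (hv.continuousOn.mono hsub)
    (fun p hp => (hu.differentiableAt one_ne_zero (hsub' p hp)).hasFDerivAt)
    (fun p hp => (hv.differentiableAt one_ne_zero (hsub' p hp)).hasFDerivAt)
    (((hcont hu _).add (hcont hv _)).integrableOn_compact isCompact_Icc)
  have hae : (Ioo r₁ r₂ ×ˢ Ioo 0 π : Set (ℝ × ℝ)) =ᵐ[volume] Icc (r₁, (0 : ℝ)) (r₂, π) := by
    rw [← Icc_prod_Icc]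
    exact Measure.set_prod_ae_eq Ioo_ae_eq_Icc Ioo_ae_eq_Icc
  rw [← setIntegral_congr_set hae] at key
  have hq : ∫ p in Ioo r₁ r₂ ×ˢ Ioo 0 π, q p.1 p.2 =
      ∫ p in Ioo r₁ r₂ ×ˢ Ioo 0 π, (fderiv ℝ (Function.uncurry (S.radialFlux f g)) p (1, 0) +
        fderiv ℝ (Function.uncurry (S.angularFlux f g)) p (0, 1)) := by
    refine setIntegral_congr_fun (measurableSet_Ioo.prod measurableSet_Ioo) fun p hp => ?_
    rw [← h p.1 hp.1 p.2 hp.2, radialDeriv, angularDeriv,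
      (hasDerivAt_radial_fderiv (hu.differentiableAt one_ne_zero (hsub' p hp))).deriv,
      (hasDerivAt_angular_fderiv (hv.differentiableAt one_ne_zero (hsub' p hp))).deriv]
  rw [hq, key]
  simp only [Function.uncurry, intervalIntegral.integral_of_le pi_pos.le,
    integral_Ioc_eq_integral_Ioo]
  simp [angularFlux]

end Green

theorem tendsto_flux_horizon (h : S.HasHorizon Ω) {f g : ℝ → ℝ → ℝ}
    (hf : IsRegularOn (Ici S.rH) f) (hg : IsRegularOn (Ici S.rH) g) :
    Tendsto (fun r => ∫ θ in Ioo 0 π, S.radialFlux f g r θ) (𝓝[>] S.rH) (𝓝 0) := by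
  obtain ⟨C, hC, hCf⟩ := hf.exists_bound (S.rH + 1)
  obtain ⟨D, hD, hDg⟩ := hg.exists_bound (S.rH + 1)
  rw [Metric.tendsto_nhds]
  intro e he
  have hπ := pi_pos
  -- The bracket in the flux is at most `2 C D` and the angular interval has length `π`; the `+ 1`
  -- guards against `C D = 0`.
  obtain ⟨δ, hδ, hb⟩ := h.bounds.2 (e / (2 * (2 * C * D + 1) * π)) (by positivity)
  filter_upwards [Ioo_mem_nhdsGT (show S.rH < S.rH + min δ 1 by simp [hδ])] with r hr
  have hr1 : r ∈ Ioo S.rH (S.rH + 1) := ⟨hr.1, hr.2.trans_le (by simp)⟩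
  have hrδ : r ∈ Ioo S.rH (S.rH + δ) := ⟨hr.1, hr.2.trans_le (by simp)⟩
  rw [dist_zero_right]
  have hle := norm_setIntegral_le_of_norm_le_const (μ := volume) (s := Ioo 0 π)
    (f := S.radialFlux f g r) (C := e / (2 * (2 * C * D + 1) * π) * (2 * C * D))
    measure_Ioo_lt_top fun θ hθ => by
      have e1 : S.radialFlux f g r θ = (r ^ 2 * S.radialCoeff r θ) * (sin θ *
          (f r θ * radialDeriv g r θ - g r θ * radialDeriv f r θ)) := by
        rw [radialFlux]; ring
      obtain ⟨f1, f2⟩ := hCf r hr1 θ hθ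
      obtain ⟨g1, g2⟩ := hDg r hr1 θ hθ
      rw [e1, norm_mul _ (sin θ * _)]
      refine mul_le_mul (hb r hrδ θ hθ) ?_ (by positivity) (by positivity)
      have h1 : ‖f r θ * radialDeriv g r θ - g r θ * radialDeriv f r θ‖ ≤ C * D + D * C := by
        refine (norm_sub_le _ _).trans ?_
        rw [norm_mul, norm_mul]
        simp only [norm_eq_abs]
        gcongr
      rw [norm_mul]
      calc _ ≤ 1 * (C * D + D * C) :=
            mul_le_mul (abs_sin_le_one θ) h1 (norm_nonneg _) zero_le_one
        _ = 2 * C * D := by ring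
  refine hle.trans_lt ?_
  have hv : volume.real (Ioo 0 π) = π := by simp [hπ.le]
  rw [hv]
  have hCD : 0 ≤ 2 * C * D := by positivity
  have : e / (2 * (2 * C * D + 1) * π) * (2 * C * D) * π =
      e * ((2 * C * D) / (2 * (2 * C * D + 1))) := by field_simp
  rw [this]
  refine mul_lt_of_lt_one_right he ?_
  rw [div_lt_one (by positivity)]
  linarith

/-- The monopole terms, including those with `M`, are multiples of `cos θ sin θ` and integrate to
zero. The dipole leaves `-3 d cos² θ sin θ`, and `∫ cos² θ sin θ = 2/3`. -/
theorem tendsto_flux_infinity (h : S.IsAMC M J) {φ₀ Φ : ℝ → ℝ → ℝ} {m d : ℝ}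
    (hφs : SmoothAbove 2 S.rH φ₀) (hΦs : SmoothAbove 2 S.rH Φ)
    (hφ₀ : HasFieldExpansion (-1) φ₀ cos fun θ => -M * cos θ)
    (hΦ : HasFieldExpansion 1 Φ (fun _ => m) fun θ => M * m + d * cos θ) :
    Tendsto (fun r => ∫ θ in Ioo 0 π, S.radialFlux φ₀ Φ r θ) atTop (𝓝 (-2 * d)) := by
  have hexp : HasExpansion (fun r θ => r⁻¹ * S.radialFlux φ₀ Φ r θ)
      (fun θ => -2 * m * (cos θ * sin θ))
      fun θ => 2 * M * m * (cos θ * sin θ) - 3 * d * (cos θ * cos θ * sin θ) := by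
    refine ((((HasExpansion.of_angle continuous_sin).mul h.radialCoeff_expansion).mul
      ((hφ₀.self.mul hΦ.radial).sub (hΦ.self.mul hφ₀.radial))).coeff_eq (fun θ => ?_)
      (fun θ => ?_)).congr ?_
    · push_cast; ring
    · push_cast; ring
    · filter_upwards [eventually_infinity_gt 0] with p hp
      have := hp.1.ne'
      simp only [radialFlux, zpow_neg, zpow_one]
      field_simp
  have hint : ∀ {u : ℝ → ℝ}, ∫ θ in Ioo 0 π, u θ = ∫ θ in (0 : ℝ)..π, u θ := fun {u} => by
    rw [intervalIntegral.integral_of_le pi_pos.le, integral_Ioc_eq_integral_Ioo]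
  have key := tendsto_integral_of_hasExpansion hexp
    (fun r hr => ((smoothAbove_radialFlux hφs hΦs).slice hr).continuous) (by
      rw [hint, intervalIntegral.integral_const_mul, integral_cos_mul_sin, mul_zero])
  have hval : ∫ θ in Ioo 0 π, (2 * M * m * (cos θ * sin θ) - 3 * d * (cos θ * cos θ * sin θ)) =
      -2 * d := by
    rw [hint, intervalIntegral.integral_sub
      ((by fun_prop : Continuous fun θ => 2 * M * m * (cos θ * sin θ)).intervalIntegrable _ _)
      ((by fun_prop : Continuous fun θ =>
        3 * d * (cos θ * cos θ * sin θ)).intervalIntegrable _ _),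
      intervalIntegral.integral_const_mul, intervalIntegral.integral_const_mul,
      integral_cos_mul_sin, integral_cos_sq_mul_sin]
    ring
  rwa [hval] at key

/-! ### The volume integral of the source -/

/-- Near the horizon the density is bounded although `N` and `A` need not extend separately; in the
middle region compactness suffices; at infinity the integrand is `O(r^{-5} · r · r²) = O(r^{-2})`.
-/
theorem integrableOn_source (h : S.IsAMC M J) (hH : S.HasHorizon Ω) {F φ₀ : ℝ → ℝ → ℝ}
    (hF : ContinuousOn (Function.uncurry F) (Ici S.rH ×ˢ Icc 0 π))
    (hFdecay : ∃ R C : ℝ, ∀ r, R < r → ∀ θ ∈ Icc 0 π, |F r θ| ≤ C / r ^ 5)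
    (hφ₀ : IsRegularOn (Ici S.rH) φ₀)
    (hexp : HasFieldExpansion (-1) φ₀ cos fun θ => -M * cos θ) :
    IntegrableOn (fun p : ℝ × ℝ => F p.1 p.2 * φ₀ p.1 p.2 * S.density p.1 p.2)
      (Ioi S.rH ×ˢ Ioo 0 π) := by
  have hFφ : ContinuousOn (fun p : ℝ × ℝ => F p.1 p.2 * φ₀ p.1 p.2) (Ici S.rH ×ˢ Icc 0 π) :=
    hF.mul (hφ₀.1.continuousOn.mono (prod_mono subset_rfl (subset_univ _)))
  have hcont : ContinuousOn (fun p : ℝ × ℝ => F p.1 p.2 * φ₀ p.1 p.2 * S.density p.1 p.2)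
      (Ioi S.rH ×ˢ Icc 0 π) :=
    (hFφ.mono (prod_mono Ioi_subset_Ici_self subset_rfl)).mul
      (S.smoothAbove_density.continuousOn.mono (prod_mono subset_rfl (subset_univ _)))
  have hmeas : ∀ s ⊆ Ioi S.rH, MeasurableSet s → AEStronglyMeasurable
      (fun p : ℝ × ℝ => F p.1 p.2 * φ₀ p.1 p.2 * S.density p.1 p.2)
      (volume.restrict (s ×ˢ Ioo 0 π)) := fun s hs hm =>
    (hcont.mono (prod_mono hs Ioo_subset_Icc_self)).aestronglyMeasurable
      (hm.prod measurableSet_Ioo)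
  have hO := (h.source_isBigO hFdecay).mul hexp.self.isBigO_one
  obtain ⟨C, hC⟩ := hO.bound
  obtain ⟨R₀, hR₀⟩ := eventually_atTop.1 (eventually_infinity (P := fun r θ =>
    ‖F r θ * S.density r θ * (r ^ (-1 : ℤ) * φ₀ r θ)‖ ≤ C * ‖r⁻¹ ^ 3 * 1‖).1 hC)
  set R := max R₀ (S.rH + 1) with hR
  have hR0 : R₀ ≤ R := le_max_left _ _
  have hRH : S.rH + 1 ≤ R := le_max_right _ _
  have hH0 := S.rH_pos
  have i1 : IntegrableOn (fun p : ℝ × ℝ => F p.1 p.2 * φ₀ p.1 p.2 * S.density p.1 p.2)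
      (Ioo S.rH (S.rH + 1) ×ˢ Ioo 0 π) := by
    obtain ⟨D, hD⟩ := hH.bounds.1
    obtain ⟨K, hK⟩ := (isCompact_Icc.prod isCompact_Icc).exists_bound_of_continuousOn
      (hFφ.mono (prod_mono
        (Icc_subset_Ici_self : Icc S.rH (S.rH + 1) ⊆ Ici S.rH) subset_rfl))
    refine IntegrableOn.of_bound ?_ (hmeas _ Ioo_subset_Ioi_self measurableSet_Ioo)
      (K * (D * (S.rH + 1) ^ 2)) ?_
    · rw [Measure.volume_eq_prod, Measure.prod_prod]
      exact ENNReal.mul_lt_top measure_Ioo_lt_top measure_Ioo_lt_top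
    · refine ae_restrict_of_forall_mem (measurableSet_Ioo.prod measurableSet_Ioo) fun p hp => ?_
      have h1 := hK p ⟨Ioo_subset_Icc_self hp.1, Ioo_subset_Icc_self hp.2⟩
      have h2 := hD p.1 hp.1 p.2 hp.2
      have hN := S.N_pos p.1 hp.1.1 p.2
      have hA := S.A_pos p.1 hp.1.1 p.2
      have hB := S.B_pos p.1 hp.1.1 p.2
      have hd := S.density_pos hp.1.1 hp.2
      have hp0 : 0 < p.1 := hH0.trans hp.1.1
      have hD0 : 0 ≤ D := le_trans (by positivity) h2
      have h3 : S.density p.1 p.2 ≤ D * (S.rH + 1) ^ 2 := by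
        have e : S.density p.1 p.2 =
            S.N p.1 p.2 * S.A p.1 p.2 * S.B p.1 p.2 ^ 2 * p.1 ^ 2 * sin p.2 := by
          rw [density]; ring
        rw [e]
        refine (mul_le_of_le_one_right (by positivity) (sin_le_one _)).trans ?_
        gcongr
        exact hp.1.2.le
      rw [norm_mul, norm_of_nonneg hd.le]
      exact mul_le_mul h1 h3 hd.le ((norm_nonneg _).trans h1)
  have i2 : IntegrableOn (fun p : ℝ × ℝ => F p.1 p.2 * φ₀ p.1 p.2 * S.density p.1 p.2)
      (Icc (S.rH + 1) R ×ˢ Icc 0 π) :=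
    (hcont.mono (prod_mono (fun r hr => (lt_add_one S.rH).trans_le hr.1)
      subset_rfl)).integrableOn_compact (isCompact_Icc.prod isCompact_Icc)
  have i3 : IntegrableOn (fun p : ℝ × ℝ => F p.1 p.2 * φ₀ p.1 p.2 * S.density p.1 p.2)
      (Ioi R ×ˢ Ioo 0 π) := by
    have hRpos : 0 < R := by linarith
    have hdom : IntegrableOn (fun p : ℝ × ℝ => p.1 ^ (-2 : ℝ) * C) (Ioi R ×ˢ Ioo 0 π) := by
      rw [IntegrableOn, Measure.volume_eq_prod, ← Measure.prod_restrict]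
      exact (integrableOn_Ioi_rpow_of_lt (by norm_num) hRpos).mul_prod
        (integrableOn_const (C := C) (s := Ioo 0 π) measure_Ioo_lt_top.ne)
    refine hdom.mono' (hmeas _ (Ioi_subset_Ioi (by linarith)) measurableSet_Ioi) ?_
    refine ae_restrict_of_forall_mem (measurableSet_Ioi.prod measurableSet_Ioo) fun p hp => ?_
    have hpR : R < p.1 := hp.1
    have hp0 : 0 < p.1 := hRpos.trans hpR
    have h1 := hR₀ p.1 (hR0.trans hpR.le) p.2 hp.2
    have e : F p.1 p.2 * φ₀ p.1 p.2 * S.density p.1 p.2 =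
        p.1 * (F p.1 p.2 * S.density p.1 p.2 * (p.1 ^ (-1 : ℤ) * φ₀ p.1 p.2)) := by
      rw [zpow_neg_one]; field_simp
    rw [e, norm_mul, norm_of_nonneg hp0.le]
    refine (mul_le_mul_of_nonneg_left h1 hp0.le).trans_eq ?_
    rw [norm_of_nonneg (by positivity), rpow_neg hp0.le, rpow_two]
    field_simp
  refine ((i1.union i2).union i3).mono_set fun p hp => ?_
  rcases lt_or_ge p.1 (S.rH + 1) with h1 | h1
  · exact .inl (.inl ⟨⟨hp.1, h1⟩, hp.2⟩)
  rcases le_or_gt p.1 R with h2 | h2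
  · exact .inl (.inr ⟨⟨h1, h2⟩, Ioo_subset_Icc_self hp.2⟩)
  · exact .inr ⟨h2, hp.2⟩

theorem iUnion_shells (a : ℝ) :
    ⋃ n : ℕ, Ioo (a + 1 / ((n : ℝ) + 1)) (a + 1 + n) ×ˢ Ioo 0 π = Ioi a ×ˢ Ioo 0 π := by
  ext p
  simp only [mem_iUnion, mem_prod]
  constructor
  · rintro ⟨n, h1, h2⟩
    exact ⟨lt_trans (by simp; positivity) h1.1, h2⟩
  · rintro ⟨h1, h2⟩
    obtain ⟨n, hn⟩ := exists_nat_one_div_lt (sub_pos.2 (mem_Ioi.1 h1))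
    obtain ⟨m, hm⟩ := exists_nat_gt (p.1 - a - 1)
    refine ⟨max n m, ⟨?_, ?_⟩, h2⟩
    · have : 1 / (((max n m : ℕ) : ℝ) + 1) ≤ 1 / ((n : ℝ) + 1) :=
        one_div_le_one_div_of_le (by positivity) (by simp)
      linarith
    · have : (m : ℝ) ≤ ((max n m : ℕ) : ℝ) := by simp
      linarith

theorem dipole_eq_integral (h : S.IsAMC M J) (hH : S.HasHorizon Ω) {F φ₀ Φ : ℝ → ℝ → ℝ}
    (hint : IntegrableOn (fun p : ℝ × ℝ => F p.1 p.2 * φ₀ p.1 p.2 * S.density p.1 p.2)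
      (Ioi S.rH ×ˢ Ioo 0 π))
    (hφ₀ : IsRegularOn (Ici S.rH) φ₀)
    (hφ₀eq : ∀ x ∈ S.exterior, dAlembertian S.metric (lift φ₀) x = 0)
    (hΦ : IsRegularOn (Ici S.rH) Φ)
    (hΦeq : ∀ x ∈ S.exterior, dAlembertian S.metric (lift Φ) x + ε * lift F x = 0) {m d : ℝ}
    (hφ₀exp : HasFieldExpansion (-1) φ₀ cos fun θ => -M * cos θ)
    (hΦexp : HasFieldExpansion 1 Φ (fun _ => m) fun θ => M * m + d * cos θ) :
    d = ε / 2 * ∫ p in Ioi S.rH ×ˢ Ioo 0 π, F p.1 p.2 * φ₀ p.1 p.2 * S.density p.1 p.2 := by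
  have hφs := hφ₀.smoothAbove
  have hΦs := hΦ.smoothAbove
  -- The fields are controlled as `C²` functions of `r` in the open exterior only, so Green's
  -- identity is applied on an exhaustion by shells. The shell `n = 0` is empty, which `r₁ ≤ r₂`
  -- permits.
  have hgreen : ∀ n : ℕ, ∫ p in Ioo (S.rH + 1 / ((n : ℝ) + 1)) (S.rH + 1 + n) ×ˢ Ioo 0 π,
      -ε * (F p.1 p.2 * φ₀ p.1 p.2 * S.density p.1 p.2) =
      (∫ θ in Ioo 0 π, S.radialFlux φ₀ Φ (S.rH + 1 + n) θ) -
        ∫ θ in Ioo 0 π, S.radialFlux φ₀ Φ (S.rH + 1 / ((n : ℝ) + 1)) θ := fun n => by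
    have hpos : 0 < 1 / ((n : ℝ) + 1) := by positivity
    refine green_identity (q := fun r θ => -ε * (F r θ * φ₀ r θ * S.density r θ)) hφs hΦs
      (by linarith) ?_ fun r hr θ hθ => ?_
    · have : 1 / ((n : ℝ) + 1) ≤ 1 := by
        rw [div_le_one (by positivity)]; simp
      have : (0 : ℝ) ≤ n := by positivity
      linarith
    · have hr' : S.rH < r := by linarith [hr.1]
      rw [divergence_flux hφs hΦs hr', wave_equation hΦs hΦeq r hr' θ hθ,
        wave_equation hφs (F := fun _ _ => 0) (ε := 0) (fun x hx => by rw [hφ₀eq x hx]; simp)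
          r hr' θ hθ]
      ring
  have hmono : Monotone fun n : ℕ =>
      (Ioo (S.rH + 1 / ((n : ℝ) + 1)) (S.rH + 1 + n) ×ˢ Ioo 0 π : Set (ℝ × ℝ)) :=
    fun n m hnm => prod_mono (Ioo_subset_Ioo (by gcongr) (by gcongr)) subset_rfl
  have l1 := tendsto_setIntegral_of_monotone (μ := volume)
    (fun n => measurableSet_Ioo.prod measurableSet_Ioo) hmono
    (by rw [iUnion_shells]; exact hint.const_mul (-ε))
  rw [iUnion_shells] at l1
  have t1 : Tendsto (fun n : ℕ => S.rH + 1 / ((n : ℝ) + 1)) atTop (𝓝[>] S.rH) := by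
    refine tendsto_nhdsWithin_iff.2 ⟨?_, Eventually.of_forall fun n => ?_⟩
    · simpa using tendsto_one_div_add_atTop_nhds_zero_nat.const_add S.rH
    · simp only [mem_Ioi, lt_add_iff_pos_right]; positivity
  have t2 : Tendsto (fun n : ℕ => S.rH + 1 + (n : ℝ)) atTop atTop :=
    tendsto_atTop_add_const_left _ _ tendsto_natCast_atTop_atTop
  have l2 := ((tendsto_flux_infinity h hφs hΦs hφ₀exp hΦexp).comp t2).sub
    ((tendsto_flux_horizon hH hφ₀ hΦ).comp t1)
  have := tendsto_nhds_unique (l1.congr hgreen) l2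
  rw [integral_const_mul] at this
  linear_combination this / 2

end HartleThorne
end ScalarHair

namespace ScalarHair

namespace HartleThorne

variable {S : HartleThorne} {M J Ω ε : ℝ}

/-! ### The flux through a partial Cauchy surface -/

namespace PartialCauchySurface

variable (K : S.PartialCauchySurface) (f : ℝ → ℝ → ℝ)

/-- The derivative of `P - Ω T` along the closed curves of the surface. -/
def windingDensity (Ω : ℝ) (p : ℝ × ℝ × ℝ) : ℝ :=
  fderiv ℝ K.P p (0, 0, 1) - Ω * fderiv ℝ K.T p (0, 0, 1)

theorem isOpen_parameterDomain : IsOpen (S.parameterDomain univ) :=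
  isOpen_Ioi.prod (isOpen_Ioo.prod isOpen_univ)

theorem differentiableAt {p : ℝ × ℝ × ℝ} (hp : p ∈ S.parameterDomain univ) :
    DifferentiableAt ℝ K.T p ∧ DifferentiableAt ℝ K.P p :=
  ⟨(K.T_contDiff.differentiableOn one_ne_zero).differentiableAt
      (isOpen_parameterDomain.mem_nhds hp),
    (K.P_contDiff.differentiableOn one_ne_zero).differentiableAt
      (isOpen_parameterDomain.mem_nhds hp)⟩

theorem fderiv_param {p : ℝ × ℝ × ℝ} (hp : p ∈ S.parameterDomain univ) (v : ℝ × ℝ × ℝ) :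
    fderiv ℝ K.param p v = ![fderiv ℝ K.T p v, v.1, v.2.1, fderiv ℝ K.P p v] := by
  obtain ⟨hT, hP⟩ := K.differentiableAt hp
  have h : HasFDerivAt K.param (ContinuousLinearMap.pi
      ![fderiv ℝ K.T p, ContinuousLinearMap.fst ℝ ℝ (ℝ × ℝ),
        (ContinuousLinearMap.fst ℝ ℝ ℝ).comp (ContinuousLinearMap.snd ℝ ℝ (ℝ × ℝ)),
        fderiv ℝ K.P p]) p := by
    refine hasFDerivAt_pi.2 fun i => ?_
    fin_cases i
    · exact hT.hasFDerivAt
    · exact hasFDerivAt_fst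
    · exact HasFDerivAt.comp p (g := Prod.fst) (f := Prod.snd) hasFDerivAt_fst hasFDerivAt_snd
    · exact hP.hasFDerivAt
  rw [h.fderiv]
  ext i
  fin_cases i <;> rfl

/-- The `r` and `θ` components of the parametrization are the parameters themselves, so the
determinant reduces to `∂_u P - Ω ∂_u T`; the slopes of the surface in `r` and `θ` drop out. -/
theorem fluxDensity_eq {p : ℝ × ℝ × ℝ} (hp : p ∈ S.parameterDomain univ) :
    K.fluxDensity f (generator Ω) p =
      f p.1 p.2.1 * S.density p.1 p.2.1 * K.windingDensity Ω p := by
  have hx : K.param p ∈ S.exterior := ⟨hp.1, hp.2.1⟩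
  rw [fluxDensity, S.volumeDensity_metric hx, K.fderiv_param hp, K.fderiv_param hp,
    K.fderiv_param hp]
  simp [lift, param, generator, windingDensity, Matrix.det_succ_row_zero, Fin.sum_univ_succ,
    Fin.succAbove]
  ring

/-- `T` returns to its value and `P` advances by `2π` along the closed curve; the contribution of
`Ω` is therefore zero. -/
theorem integral_windingDensity {r θ : ℝ} (hr : S.rH < r) (hθ : θ ∈ Ioo 0 π) :
    ∫ u in Ioo 0 (2 * π), K.windingDensity Ω (r, θ, u) = 2 * π := by
  have hmem : ∀ u, (r, θ, u) ∈ S.parameterDomain univ := fun u => ⟨hr, hθ, mem_univ u⟩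
  have hline : ∀ u, HasDerivAt (fun u : ℝ => (r, θ, u)) (0, 0, 1) u := fun u =>
    (hasDerivAt_const u r).prodMk ((hasDerivAt_const u θ).prodMk (hasDerivAt_id u))
  have hd : ∀ u, HasDerivAt (fun u => K.P (r, θ, u) - Ω * K.T (r, θ, u))
      (K.windingDensity Ω (r, θ, u)) u := fun u => by
    obtain ⟨hT, hP⟩ := K.differentiableAt (hmem u)
    exact (hP.hasFDerivAt.comp_hasDerivAt u (hline u)).sub
      ((hT.hasFDerivAt.comp_hasDerivAt u (hline u)).const_mul Ω)
  have hl : Continuous fun u : ℝ => (r, θ, u) := by fun_prop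
  have hcont : Continuous fun u => K.windingDensity Ω (r, θ, u) := by
    have hP := ((K.P_contDiff.continuousOn_fderiv_of_isOpen isOpen_parameterDomain
      le_rfl).clm_apply (continuousOn_const (c := ((0 : ℝ), (0 : ℝ), (1 : ℝ))))).comp_continuous
      hl hmem
    have hT := ((K.T_contDiff.continuousOn_fderiv_of_isOpen isOpen_parameterDomain
      le_rfl).clm_apply (continuousOn_const (c := ((0 : ℝ), (0 : ℝ), (1 : ℝ))))).comp_continuous
      hl hmem
    exact hP.sub (hT.const_mul Ω)
  rw [← integral_Ioc_eq_integral_Ioo, ← intervalIntegral.integral_of_le two_pi_pos.le,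
    intervalIntegral.integral_eq_sub_of_hasDerivAt (fun u _ => hd u)
      (hcont.intervalIntegrable _ _)]
  have hT := K.T_periodic r θ 0
  have hP := K.P_periodic r θ 0
  rw [zero_add] at hT hP
  rw [hT, hP]
  ring

theorem windingDensity_of_isAxisymmetric (hK : K.IsAxisymmetric) {p : ℝ × ℝ × ℝ}
    (hp : p ∈ S.parameterDomain univ) : K.windingDensity Ω p = 1 := by
  obtain ⟨r, θ, u⟩ := p
  obtain ⟨hT, hP⟩ := K.differentiableAt hp
  have hline : HasDerivAt (fun u : ℝ => (r, θ, u)) (0, 0, 1) u :=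
    (hasDerivAt_const u r).prodMk ((hasDerivAt_const u θ).prodMk (hasDerivAt_id u))
  have dT := hT.hasFDerivAt.comp_hasDerivAt u hline
  have dP := hP.hasFDerivAt.comp_hasDerivAt u hline
  have eT : (K.T ∘ fun u : ℝ => (r, θ, u)) = fun _ => K.T (r, θ, 0) :=
    funext fun u => (hK r θ u).1
  have eP : (K.P ∘ fun u : ℝ => (r, θ, u)) = fun u => K.P (r, θ, 0) + u :=
    funext fun u => (hK r θ u).2
  rw [eT] at dT
  rw [eP] at dP
  rw [windingDensity, dT.unique (hasDerivAt_const u _),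
    dP.unique ((hasDerivAt_id u).const_add _)]
  ring

/-- Regrouping the parameters as `((r, θ), u)` lets Fubini's theorem integrate out the curve
parameter. -/
theorem measurePreserving_assoc :
    MeasurePreserving (MeasurableEquiv.prodAssoc : (ℝ × ℝ) × ℝ ≃ᵐ ℝ × ℝ × ℝ) volume volume :=
  measurePreserving_prodAssoc volume volume volume

theorem preimage_parameterDomain (U : Set ℝ) :
    (MeasurableEquiv.prodAssoc : (ℝ × ℝ) × ℝ ≃ᵐ ℝ × ℝ × ℝ) ⁻¹' S.parameterDomain U =
      (Ioi S.rH ×ˢ Ioo 0 π) ×ˢ U := by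
  ext p
  simp [parameterDomain, MeasurableEquiv.prodAssoc, and_assoc]

theorem fluxDensity_assoc {q : (ℝ × ℝ) × ℝ} (hq : q ∈ (Ioi S.rH ×ˢ Ioo 0 π) ×ˢ Ioo 0 (2 * π)) :
    K.fluxDensity f (generator Ω) (MeasurableEquiv.prodAssoc q) =
      f q.1.1 q.1.2 * S.density q.1.1 q.1.2 * K.windingDensity Ω (q.1.1, q.1.2, q.2) :=
  K.fluxDensity_eq f (p := (q.1.1, q.1.2, q.2)) ⟨hq.1.1, hq.1.2, mem_univ _⟩

theorem measurableSet_assoc :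
    MeasurableSet ((Ioi S.rH ×ˢ Ioo 0 π) ×ˢ Ioo 0 (2 * π) : Set ((ℝ × ℝ) × ℝ)) :=
  (measurableSet_Ioi.prod measurableSet_Ioo).prod measurableSet_Ioo

theorem fluxConverges_iff : K.FluxConverges f (generator Ω) ↔
    IntegrableOn (fun q : (ℝ × ℝ) × ℝ => f q.1.1 q.1.2 * S.density q.1.1 q.1.2 *
      K.windingDensity Ω (q.1.1, q.1.2, q.2)) ((Ioi S.rH ×ˢ Ioo 0 π) ×ˢ Ioo 0 (2 * π)) := by
  rw [FluxConverges, ← measurePreserving_assoc.integrableOn_comp_preimage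
    (MeasurableEquiv.measurableEmbedding _), preimage_parameterDomain]
  exact integrableOn_congr_fun (fun q hq => K.fluxDensity_assoc f hq) measurableSet_assoc

theorem fluxConverges_of_isAxisymmetric (hK : K.IsAxisymmetric)
    (hf : IntegrableOn (fun p : ℝ × ℝ => f p.1 p.2 * S.density p.1 p.2)
      (Ioi S.rH ×ˢ Ioo 0 π)) : K.FluxConverges f (generator Ω) := by
  rw [fluxConverges_iff, integrableOn_congr_fun (fun q hq => by
    rw [K.windingDensity_of_isAxisymmetric hK ⟨hq.1.1, hq.1.2, mem_univ _⟩])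
    measurableSet_assoc, IntegrableOn, Measure.volume_eq_prod, ← Measure.prod_restrict]
  exact hf.mul_prod (integrableOn_const (C := (1 : ℝ)) (s := Ioo 0 (2 * π)) measure_Ioo_lt_top.ne)

/-- Absolute convergence is what justifies integrating over `u` first; `windingDensity` of a general
surface carries no bound uniform in `(r, θ)`. -/
theorem flux_eq (hK : K.FluxConverges f (generator Ω)) :
    K.flux f (generator Ω) =
      2 * π * ∫ p in Ioi S.rH ×ˢ Ioo 0 π, f p.1 p.2 * S.density p.1 p.2 := by
  rw [fluxConverges_iff] at hK
  rw [flux, ← measurePreserving_assoc.setIntegral_preimage_emb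
    (MeasurableEquiv.measurableEmbedding _), preimage_parameterDomain,
    setIntegral_congr_fun measurableSet_assoc fun q hq => K.fluxDensity_assoc f hq,
    Measure.volume_eq_prod, setIntegral_prod _ hK, ← integral_const_mul]
  refine setIntegral_congr_fun (measurableSet_Ioi.prod measurableSet_Ioo) fun p hp => ?_
  simp only
  rw [integral_const_mul, K.integral_windingDensity hp.1 hp.2]
  ring

end PartialCauchySurface
end HartleThorne
end ScalarHair

end

theorem mainTheorem4
    (S : HartleThorne) (M J Ω ε : ℝ)
    (hAMC : S.IsAMC M J) (hhor : S.HasHorizon Ω)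
    -- the source: continuous up to the horizon, falling off at least as fast as `r^{-5}`
    (F : ℝ → ℝ → ℝ)
    (hF : ContinuousOn (Function.uncurry F) (Ici S.rH ×ˢ Icc 0 π))
    (hFdecay : ∃ R C : ℝ, ∀ r, R < r → ∀ θ ∈ Icc 0 π, |F r θ| ≤ C / r ^ 5)
    -- the scalar field, regular up to the horizon, with its expansion at infinity
    (Φ : ℝ → ℝ → ℝ) (hΦ : IsRegularOn (Ici S.rH) Φ)
    (hΦeq : ∀ x ∈ S.exterior, dAlembertian S.metric (lift Φ) x + ε * lift F x = 0)
    (μ₁ μ₂ : ℝ → ℝ)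
    (hΦexp : IsRemainder 3 (fun r θ => Φ r θ - (μ₁ θ / r + μ₂ θ / r ^ 2)))
    -- the homogeneous solution, regular up to the horizon, asymptotic to `r P₁(cos θ)`
    (φ₀ : ℝ → ℝ → ℝ) (hφ₀ : IsRegularOn (Ici S.rH) φ₀)
    (hφ₀eq : ∀ x ∈ S.exterior, dAlembertian S.metric (lift φ₀) x = 0)
    (hφ₀lim : ∀ θ ∈ Icc 0 π, cos θ ≠ 0 →
      Tendsto (fun r => φ₀ r θ / (r * cos θ)) atTop (𝓝 1))
    (hφ₀exp : ∃ (c₀ c₁ : ℝ → ℝ) (ρ : ℝ → ℝ → ℝ), Continuous c₀ ∧ Continuous c₁ ∧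
      IsRemainder 2 ρ ∧
      ∀ᶠ r in atTop, ∀ θ, φ₀ r θ = r * cos θ * (c₀ θ + c₁ θ / r + ρ r θ)) :
    -- asymptotics of the homogeneous solution
    (∃ ρ : ℝ → ℝ → ℝ, IsRemainder 2 ρ ∧
      ∀ᶠ r in atTop, ∀ θ, φ₀ r θ = r * cos θ * (1 - M / r + ρ r θ)) ∧
    -- the monopole and dipole hair
    (∃ m₁ : ℝ, ∀ θ, μ₁ θ = m₁ ∧ μ₂ θ = M * m₁ + dipoleMode μ₂ * cos θ) ∧
    -- the formula for the `ℓ = 1` mode of the dipole hair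
    (∀ K : S.PartialCauchySurface, K.IsAxisymmetric →
      K.FluxConverges (fun r θ => F r θ * φ₀ r θ) (HartleThorne.generator Ω)) ∧
    (∀ K : S.PartialCauchySurface,
      K.FluxConverges (fun r θ => F r θ * φ₀ r θ) (HartleThorne.generator Ω) →
      dipoleMode μ₂ =
        ε / (4 * π) * K.flux (fun r θ => F r θ * φ₀ r θ) (HartleThorne.generator Ω)) := by
  obtain ⟨R, ρ, hρ, hasym⟩ := HartleThorne.homogeneous_asymptotics hAMC hφ₀ hφ₀eq hφ₀lim hφ₀exp
  obtain ⟨m₁, hμ, hΦe⟩ := HartleThorne.scalar_hair hAMC hFdecay hΦ hΦeq hΦexp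
  have hφe := HartleThorne.homogeneous_expansion hρ hasym
  have hint := HartleThorne.integrableOn_source hAMC hhor hF hFdecay hφ₀ hφe
  refine ⟨⟨ρ, hρ, (eventually_gt_atTop R).mono fun r hr => hasym r hr⟩, ⟨m₁, hμ⟩,
    fun K hK => K.fluxConverges_of_isAxisymmetric _ hK hint, fun K hK => ?_⟩
  rw [K.flux_eq _ hK]
  -- The factors match because `ε / 2 = (ε / 4π) · 2π`.
  refine (HartleThorne.dipole_eq_integral hAMC hhor hint hφ₀ hφ₀eq hΦ hΦeq hφe hΦe).trans ?_
  field_simp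
  ring
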